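/- **Setting.** Let $N\ge 1$ and let $\mathcal G$ be a directed graph without self-loops on the nodes $1,\dots,N$. Let $\mathcal V_i=\{j:(j,i)\in\mathcal E\}$ be the neighbourhood of $i$, listed in ascending order, let $p_i=|\mathcal V_i|$ be the in-degree and $q_i=|\{j: i\in\mathcal V_j\}|$ the out-degree. Let $0=t_0<t_1<\cdots$, $t_k\to\infty$, be sampling instants such that $$\tau_i=\sup_k\,(t_{k+1}-t_{k-p_i+1})<\infty ,\qquad i=1,\dots,N ,$$ with $t_m:=0$ for $m<0$. Let $\Pi\{j_1,\dots,j_p\}=\{j_p,j_1,\dots,j_{p-1}\}$ and let $\nu_j=\nu_j^{k,i}\in\{1,\dots,p_i\}$ be the position of $j$ in $\Pi^k(\mathcal V_i)$. The plant and the measurements are $$\dot x=Ax+B_2w,\quad x(t)=x_0\in\mathbb R^n\ (t\le 0),\qquad y_i=C_ix+D_{2i}w+\bar D_{2i}v_i,$$ and the observers, with given matrices $H_i$ and gains $K_i,L_i$, are, for $t\in[t_k,t_{k+1})$, $k=0,1,\dots$, $$\dot{\hat x}_i=A\hat x_i+L_i(y_i-C_i\hat x_i)+K_i\sum_{j\in\mathcal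 V_i}H_i\bigl(\hat x_j(t_{k-\nu_j+1})-\hat x_i(t_{k-\nu_j+1})\bigr),\qquad \hat x_i(t)=0\ (t\le0).$$ All differential equations are understood in the Carathéodory sense. Put $\xi_i=[w'\ v_i']'$, $B=[B_2\ 0]$, $D_i=[D_{2i}\ \bar D_{2i}]$. The errors $e_i=x-\hat x_i$ satisfy $$\dot e_i=(A-L_iC_i)e_i+(B-L_iD_i)\xi_i+K_iH_i\sum_{j\in\mathcal V_i}\bigl(e_j(t_{k-\nu_j+1})-e_i(t_{k-\nu_j+1})\bigr),\quad t\in[t_k,t_{k+1}).\tag{1}$$ **The problem.** Let $\gamma>0$. The gains $K_i,L_i$ *solve the distributed estimation problem with the weight $P=P'>0$* if (i) the system (1) with $\xi=0$ is exponentially stable: there are $c,\beta>0$ such that for every $m\ge0$, all vectors $\varphi_1,\dots,\varphi_N\in\mathbb R^n$ and every solution of (1) on $[t_m,\infty)$ with $\xi=0$ and $e_i(t)=\varphi_i$ for $t\le t_m$, $$\sum_i\|e_i(t)\|^2\le c\,e^{-2\beta (t-t_m)}\sum_i\|\varphi_i\|^2 ,\qquad t\ge t_m;$$ (ii) for all $x_0$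 and all $w,v_1,\dots,v_N\in L_2[0,\infty)$, $$J:=\frac1N\int_0^\infty\sum_{i=1}^N\sum_{j\in\mathcal V_i}\|\hat x_j-\hat x_i\|^2dt\ \le\ \gamma^2\Bigl(x_0'Px_0+\frac1N\sum_{i=1}^N\int_0^\infty\|\xi_i\|^2dt\Bigr)$$ (in particular $J<\infty$). **Matrices.** Given $Y_i,X_i,F_i,U_i,S_i,R_i,W_i,G_i$ and scalars $\alpha_i,\pi_i,\epsilon_i,\bar\epsilon_i$, let $\Psi_i$ be the matrix with $(p_i+1)\times(p_i+1)$ blocks of size $n\times n$, with diagonal blocks $R_i$ and all other blocks $\frac12(G_i+G_i')$. Let $T_i$ be the $(p_i+1)n\times(p_i+2)n$ matrix with $T_i\,[\bar e_0',\dots,\bar e_{p_i+1}']'=[(\bar e_0-\bar e_1)',\dots,(\bar e_{p_i}-\bar e_{p_i+1})']'$. Partition $\bar\Psi_i=e^{-2\alpha_i\tau_i}T_i'\Psi_iT_i$ into $3\times3$ blocks of sizes $n,\ p_in,\ n$. Let $\tilde\Psi_{i,11}=\bar\Psi_{i,11}-2\alpha_iY_i^{-1}-S_i$, $\tilde\Psi_{i,33}=\bar\Psi_{i,33}+e^{-2\alpha_i\tau_i}S_i$,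 and $\tilde\Psi_{i,\mu\nu}=\bar\Psi_{i,\mu\nu}$ otherwise. Let $\bar\Phi_{i,11}$ and $\bar\Phi_{i,22}$ be block-diagonal with the blocks $\pi_jY_j^{-1}+\frac{\pi^2}4W_j$ and $\frac{\pi^2}{4}W_j$, $j\in\mathcal V_i$, respectively ($\pi$ without index is the number $3.14\ldots$), and $\bar\Phi_{i,12}=-\bar\Phi_{i,22}$. Let $\bar\Xi_i$ be the symmetric matrix $$\bar\Xi_i=\begin{bmatrix} \bar\Xi_{aa}&\bar\Xi_{ab}&\bar\Xi_{ac}&0&0&\bar\Xi_{af}&\bar\Xi_{ag}\\ \star&\bar\Xi_{bb}&\bar\Xi_{bc}&-\tilde\Psi_{i,13}&\bar\Xi_{be}&\bar\Xi_{bf}&\bar\Xi_{bg}\\ \star&\star&-\tilde\Psi_{i,22}&-\tilde\Psi_{i,23}&0&\bar\Xi_{cf}&0\\ \star&\star&\star&-\tilde\Psi_{i,33}&0&0&0\\ \star&\star&\star&\star&-\bar\Phi_{i,11}&-\bar\Phi_{i,12}&0\\ \star&\star&\star&\star&\star&\bar\Xi_{ff}&\bar\Xi_{fg}\\ \star&\star&\star&\star&\star&\star&-I\end{bmatrix}$$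 where, with $\mathbf 1=\mathbf 1_{p_i}$, $$\begin{aligned} \bar\Xi_{aa}&=\tau_i^2R_i+\Bigl(\sum_{j:\,i\in\mathcal V_j}\tau_j^2\Bigr)W_i-\epsilon_iX_i-\epsilon_iX_i', & \bar\Xi_{ab}&=Y_i^{-1}-X_i+\epsilon_i(X_i'A-U_iC_i),\\ \bar\Xi_{ac}&=-\epsilon_i(\mathbf 1'\otimes F_iH_i), & \bar\Xi_{af}&=\mathbf 1'\otimes(-\bar\epsilon_iX_i+\epsilon_iF_iH_i),\\ \bar\Xi_{ag}&=\epsilon_i(X_i'B-U_iD_i), & \bar\Xi_{bb}&=\tfrac{p_i+q_i}{\gamma^2}I-\tilde\Psi_{i,11}+X_i'A-U_iC_i+A'X_i-C_i'U_i',\\ \bar\Xi_{bc}&=-\tilde\Psi_{i,12}-\mathbf 1'\otimes(F_iH_i), & \bar\Xi_{be}&=-\tfrac1{\gamma^2}(\mathbf 1'\otimes I),\\ \bar\Xi_{bf}&=\mathbf 1'\otimes(F_iH_i+\bar\epsilon_iA'X_i-\bar\epsilon_iC_i'U_i'), & \bar\Xi_{bg}&=X_i'B-U_iD_i,\\ \bar\Xi_{cf}&=-\mathbf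 1\mathbf 1'\otimes(\bar\epsilon_iH_i'F_i'), & \bar\Xi_{ff}&=\bar\epsilon_i\mathbf 1\mathbf 1'\otimes(F_iH_i+H_i'F_i')-\bar\Phi_{i,22},\\ \bar\Xi_{fg}&=\bar\epsilon_i\mathbf 1\otimes(X_i'B-U_iD_i). \end{aligned}$$ **Theorem.** Suppose there are matrices $Y_i=Y_i'>0$, $X_i$ with $\det X_i\ne0$, $F_i$, $U_i$, $S_i=S_i'\ge0$, $R_i=R_i'\ge0$, $W_i=W_i'\ge0$, $G_i$ and constants $\alpha_i>0$, $\pi_i\ge0$ with $q_i\pi_i<2\alpha_i$, $\epsilon_i>0$, $\bar\epsilon_i>0$ such that, for every $i=1,\dots,N$, $$\begin{bmatrix}R_i&G_i\\G_i'&R_i\end{bmatrix}\ge0\qquad\text{and}\qquad\bar\Xi_i<0 .$$ Then the network of observers with the gains $K_i=(X_i')^{-1}F_i$, $L_i=(X_i')^{-1}U_i$ solves the distributed estimation problem with level $\gamma$ and with the weight $$P=\frac1N\sum_{i=1}^N\Bigl(Y_i^{-1}+S_i\,\frac{1-e^{-2\alpha_i\tau_i}}{2\alpha_i}\Bigr).$$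 -/

import Mathlib

open Matrix MeasureTheory

noncomputable section

/-- The data of the estimation problem: a directed graph on the nodes `Fin N` without self-loops
(`Edge j i` is the edge from `j` to `i`), the plant, the sensors, the matrices `H i`, and the
sampling instants. -/
structure RRNetwork (N n mw mv : ℕ) (r h : Fin N → ℕ) where
  Edge : Fin N → Fin N → Prop
  loopless : ∀ i, ¬ Edge i i
  A : Matrix (Fin n) (Fin n) ℝ
  B₂ : Matrix (Fin n) (Fin mw) ℝ
  C : ∀ i, Matrix (Fin (r i)) (Fin n) ℝ
  D₂ : ∀ i, Matrix (Fin (r i)) (Fin mw) ℝ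
  Dbar₂ : ∀ i, Matrix (Fin (r i)) (Fin mv) ℝ
  H : ∀ i, Matrix (Fin (h i)) (Fin n) ℝ
  /-- The sampling instants. -/
  t : ℕ → ℝ
  t_zero : t 0 = 0
  t_strictMono : StrictMono t
  t_tendsto : Filter.Tendsto t Filter.atTop Filter.atTop

namespace RRNetwork

variable {N n mw mv : ℕ} {r h : Fin N → ℕ} (net : RRNetwork N n mw mv r h)

/-! ### Graph and schedule -/

open Classical in
/-- The neighbourhood of `i`: the nodes that supply information to `i`. -/
def nbr (i : Fin N) : Finset (Fin N) := Finset.univ.filter fun j => net.Edge j i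

open Classical in
/-- The nodes that receive information from `i`. -/
def outNbr (i : Fin N) : Finset (Fin N) := Finset.univ.filter fun j => net.Edge i j

/-- The in-degree. -/
def p (i : Fin N) : ℕ := (net.nbr i).card

/-- The out-degree. -/
def q (i : Fin N) : ℕ := (net.outNbr i).card

/-- The shift permutation `{j₁, …, j_{p-1}, j_p} ↦ {j_p, j₁, …, j_{p-1}}`. -/
def shift {α : Type*} (l : List α) : List α := l.rotate (l.length - 1)

/-- The neighbourhood of `i` in ascending order, shifted `k` times. -/
def polling (i : Fin N) (k : ℕ) : List (Fin N) := shift^[k] ((net.nbr i).sort (· ≤ ·))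

/-- The position, in `{1, …, p i}`, of the neighbour `j` in the `k`-th shifted neighbourhood. -/
def ν (i : Fin N) (k : ℕ) (j : Fin N) : ℕ := (net.polling i k).idxOf j + 1

/-- The instant `t_{k - ν_j + 1}` of the sample from channel `(j, i)` that is in use on
`[t_k, t_{k+1})`. If the index would be negative (the channel has not been polled yet), the
truncated subtraction gives `t₀ = 0`, where all signals still have their initial values. -/
def sampleTime (i : Fin N) (k : ℕ) (j : Fin N) : ℝ := net.t (k + 1 - net.ν i k j)

/-- The times `t_{k+1} - t_{k-p_i+1}` between two consecutive polls of a channel of node `i`.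
For `k + 1 < p i` the truncated subtraction gives `t_{k+1} - t_0`, which does not exceed the value
`t_{p i} - t_0` at `k = p i - 1`. -/
def pollGap (i : Fin N) (k : ℕ) : ℝ := net.t (k + 1) - net.t (k + 1 - net.p i)

/-- The maximal delay `τ_i`. -/
def τ (i : Fin N) : ℝ := ⨆ k, net.pollGap i k

/-! ### Plant, observers, estimation errors -/

/-- `x` solves `ẋ = A x + B₂ w`, `x(s) = x₀` for `s ≤ 0` (in the sense of Carathéodory). -/
def IsPlantTrajectory (x₀ : Fin n → ℝ) (w : ℝ → Fin mw → ℝ) (x : ℝ → Fin n → ℝ) : Prop :=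
  Continuous x ∧ (∀ s ≤ 0, x s = x₀) ∧
    ∀ s, 0 ≤ s → x s = x₀ + ∫ u in (0 : ℝ)..s, (net.A *ᵥ x u + net.B₂ *ᵥ w u)

/-- The measurement of node `i`. -/
def y (x : ℝ → Fin n → ℝ) (w : ℝ → Fin mw → ℝ) (v : Fin N → ℝ → Fin mv → ℝ) (i : Fin N) (s : ℝ) :
    Fin (r i) → ℝ :=
  net.C i *ᵥ x s + net.D₂ i *ᵥ w s + net.Dbar₂ i *ᵥ v i s

/-- `xh` solves the observer equations under the Round-Robin protocol with gains `K`, `L`, with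
zero initial conditions, driven by the measurements `y`. -/
def IsObserverTrajectory (K : ∀ i, Matrix (Fin n) (Fin (h i)) ℝ)
    (L : ∀ i, Matrix (Fin n) (Fin (r i)) ℝ) (y : ∀ i, ℝ → Fin (r i) → ℝ)
    (xh : Fin N → ℝ → Fin n → ℝ) : Prop :=
  (∀ i, Continuous (xh i)) ∧ (∀ i, ∀ s ≤ 0, xh i s = 0) ∧
    ∀ i k, ∀ s ∈ Set.Icc (net.t k) (net.t (k + 1)),
      xh i s = xh i (net.t k) + ∫ u in (net.t k)..s,
        (net.A *ᵥ xh i u + L i *ᵥ (y i u - net.C i *ᵥ xh i u) +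
          K i *ᵥ ∑ j ∈ net.nbr i,
            net.H i *ᵥ (xh j (net.sampleTime i k j) - xh i (net.sampleTime i k j)))

/-- `B = [B₂ 0]`. -/
def B : Matrix (Fin n) (Fin mw ⊕ Fin mv) ℝ := fromCols net.B₂ 0

/-- `D_i = [D_{2i} D̄_{2i}]`. -/
def D (i : Fin N) : Matrix (Fin (r i)) (Fin mw ⊕ Fin mv) ℝ := fromCols (net.D₂ i) (net.Dbar₂ i)

/-- `e` solves the interconnected error equations, started at the sampling instant `t_m` with
`e_i(s) = φ_i` for all `s ≤ t_m`, and perturbed by `ξ`. -/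
def IsErrorTrajectory (K : ∀ i, Matrix (Fin n) (Fin (h i)) ℝ)
    (L : ∀ i, Matrix (Fin n) (Fin (r i)) ℝ) (ξ : Fin N → ℝ → (Fin mw ⊕ Fin mv) → ℝ)
    (m : ℕ) (φ : Fin N → Fin n → ℝ) (e : Fin N → ℝ → Fin n → ℝ) : Prop :=
  (∀ i, Continuous (e i)) ∧ (∀ i, ∀ s ≤ net.t m, e i s = φ i) ∧
    ∀ i, ∀ k ≥ m, ∀ s ∈ Set.Icc (net.t k) (net.t (k + 1)),
      e i s = e i (net.t k) + ∫ u in (net.t k)..s,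
        ((net.A - L i * net.C i) *ᵥ e i u + (net.B - L i * net.D i) *ᵥ ξ i u +
          (K i * net.H i) *ᵥ ∑ j ∈ net.nbr i,
            (e j (net.sampleTime i k j) - e i (net.sampleTime i k j)))

/-- Exponential stability of the unperturbed interconnected error system, uniform in the sampling
instant at which it is started; the initial values at the nodes are arbitrary.
Here `z ⬝ᵥ z` is the squared Euclidean norm. -/
def ExponentiallyStable (K : ∀ i, Matrix (Fin n) (Fin (h i)) ℝ)
    (L : ∀ i, Matrix (Fin n) (Fin (r i)) ℝ) : Prop :=
  ∃ c > 0, ∃ β > 0, ∀ (m : ℕ) (φ : Fin N → Fin n → ℝ) (e : Fin N → ℝ → Fin n → ℝ),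
    net.IsErrorTrajectory K L (fun _ _ => 0) m φ e → ∀ s ≥ net.t m,
      ∑ i, e i s ⬝ᵥ e i s ≤ c * Real.exp (-2 * β * (s - net.t m)) * ∑ i, φ i ⬝ᵥ φ i

/-- The integrand of the cost of disagreement. -/
def disagreement (xh : Fin N → ℝ → Fin n → ℝ) (s : ℝ) : ℝ :=
  ∑ i, ∑ j ∈ net.nbr i, (xh j s - xh i s) ⬝ᵥ (xh j s - xh i s)

/-- The consensus performance level `γ` with the weight `P`: for all initial states `x₀` and all
square integrable disturbances, the cost `J` of disagreement is finite and
`J ≤ γ² (x₀' P x₀ + (1/N) ∑ᵢ ∫ ‖ξᵢ‖²)`, where `ξᵢ = [w' vᵢ']'`. -/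
def ConsensusPerformance (K : ∀ i, Matrix (Fin n) (Fin (h i)) ℝ)
    (L : ∀ i, Matrix (Fin n) (Fin (r i)) ℝ) (γ : ℝ) (P : Matrix (Fin n) (Fin n) ℝ) : Prop :=
  ∀ (x₀ : Fin n → ℝ) (w : ℝ → Fin mw → ℝ) (v : Fin N → ℝ → Fin mv → ℝ)
    (x : ℝ → Fin n → ℝ) (xh : Fin N → ℝ → Fin n → ℝ),
    MemLp w 2 (volume.restrict (Set.Ioi 0)) →
    (∀ i, MemLp (v i) 2 (volume.restrict (Set.Ioi 0))) →
    net.IsPlantTrajectory x₀ w x →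
    net.IsObserverTrajectory K L (net.y x w v) xh →
      IntegrableOn (net.disagreement xh) (Set.Ioi 0) ∧
      (1 / (N : ℝ)) * ∫ s in Set.Ioi (0 : ℝ), net.disagreement xh s ≤
        γ ^ 2 * (x₀ ⬝ᵥ (P *ᵥ x₀) +
          (1 / (N : ℝ)) * ∑ i, ∫ s in Set.Ioi (0 : ℝ), (w s ⬝ᵥ w s + v i s ⬝ᵥ v i s))

/-- The gains `K`, `L` solve the distributed estimation problem with level `γ` and weight `P`. -/
def SolvesEstimationProblem (K : ∀ i, Matrix (Fin n) (Fin (h i)) ℝ)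
    (L : ∀ i, Matrix (Fin n) (Fin (r i)) ℝ) (γ : ℝ) (P : Matrix (Fin n) (Fin n) ℝ) : Prop :=
  net.ExponentiallyStable K L ∧ P.PosDef ∧ net.ConsensusPerformance K L γ P

end RRNetwork

/-! ### Block matrices -/

namespace RRBlock

/-- `𝟏' ⊗ M`. -/
def oneRow (ι : Type*) {α β : Type*} (M : Matrix α β ℝ) : Matrix α (ι × β) ℝ :=
  of fun a b => M a b.2

/-- `𝟏 ⊗ M`. -/
def oneCol (ι : Type*) {α β : Type*} (M : Matrix α β ℝ) : Matrix (ι × α) β ℝ :=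
  of fun a b => M a.2 b

/-- `𝟏 𝟏' ⊗ M`. -/
def oneFull (ι κ : Type*) {α β : Type*} (M : Matrix α β ℝ) : Matrix (ι × α) (κ × β) ℝ :=
  of fun a b => M a.2 b.2

/-- The block-diagonal matrix with diagonal blocks `M j`. -/
def blkDiag {ι α : Type*} [DecidableEq ι] (M : ι → Matrix α α ℝ) : Matrix (ι × α) (ι × α) ℝ :=
  of fun a b => if a.1 = b.1 then M a.1 a.2 b.2 else 0

/-- The symmetric block matrix with upper triangle `M₁₁`, `M₁₂`, `M₂₂`. -/
def sym {α β : Type*} (M₁₁ : Matrix α α ℝ) (M₁₂ : Matrix α β ℝ) (M₂₂ : Matrix β β ℝ) :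
    Matrix (α ⊕ β) (α ⊕ β) ℝ :=
  fromBlocks M₁₁ M₁₂ M₁₂ᵀ M₂₂

/-- `Ψ`: `p + 1` diagonal blocks `R`, all other blocks `(G + G') / 2`. -/
def Psi {n : ℕ} (p : ℕ) (R G : Matrix (Fin n) (Fin n) ℝ) :
    Matrix (Fin (p + 1) × Fin n) (Fin (p + 1) × Fin n) ℝ :=
  of fun a b => if a.1 = b.1 then R a.2 b.2 else ((1 / 2 : ℝ) • (G + Gᵀ)) a.2 b.2

/-- `T`: maps `(ē_0, …, ē_{p+1})` to its successive differences `δ_ν = ē_ν - ē_{ν+1}`,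
`ν = 0, …, p`. It is applied to `ē = (e(t), e(t_k), …, e(t_{k-p+1}), e(t-τ))`. -/
def T (n p : ℕ) : Matrix (Fin (p + 1) × Fin n) (Fin (p + 2) × Fin n) ℝ :=
  of fun a b => ((if b.1 = a.1.castSucc then 1 else 0) - (if b.1 = a.1.succ then 1 else 0)) *
    (1 : Matrix (Fin n) (Fin n) ℝ) a.2 b.2

/-- `Ψ̄ = e^{-2ατ} T' Ψ T`. -/
def PsiBar {n : ℕ} (p : ℕ) (R G : Matrix (Fin n) (Fin n) ℝ) (α τ : ℝ) :
    Matrix (Fin (p + 2) × Fin n) (Fin (p + 2) × Fin n) ℝ :=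
  Real.exp (-2 * α * τ) • ((T n p)ᵀ * Psi p R G * T n p)

/-- The first block of the partition of `ē`, that is `e(t)`. -/
def i₁ {n : ℕ} (p : ℕ) (a : Fin n) : Fin (p + 2) × Fin n := (0, a)

/-- The middle block of the partition of `ē`, that is the `p` samples. -/
def i₂ {n : ℕ} (p : ℕ) (a : Fin p × Fin n) : Fin (p + 2) × Fin n := (a.1.succ.castSucc, a.2)

/-- The last block of the partition of `ē`, that is `e(t-τ)`. -/
def i₃ {n : ℕ} (p : ℕ) (a : Fin n) : Fin (p + 2) × Fin n := (Fin.last (p + 1), a)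

end RRBlock

/-- The decision variables of the synthesis conditions; `pi i` is the scalar `π_i`. -/
structure RRDesign (N n : ℕ) (r h : Fin N → ℕ) where
  Y : Fin N → Matrix (Fin n) (Fin n) ℝ
  X : Fin N → Matrix (Fin n) (Fin n) ℝ
  F : ∀ i, Matrix (Fin n) (Fin (h i)) ℝ
  U : ∀ i, Matrix (Fin n) (Fin (r i)) ℝ
  S : Fin N → Matrix (Fin n) (Fin n) ℝ
  R : Fin N → Matrix (Fin n) (Fin n) ℝ
  W : Fin N → Matrix (Fin n) (Fin n) ℝ
  G : Fin N → Matrix (Fin n) (Fin n) ℝ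
  α : Fin N → ℝ
  pi : Fin N → ℝ
  ε : Fin N → ℝ
  εbar : Fin N → ℝ

namespace RRDesign

open RRBlock

variable {N n mw mv : ℕ} {r h : Fin N → ℕ} (d : RRDesign N n r h) (net : RRNetwork N n mw mv r h)

/-- The interconnection gains `K_i = (X_i')⁻¹ F_i`. -/
def K (i : Fin N) : Matrix (Fin n) (Fin (h i)) ℝ := ((d.X i)ᵀ)⁻¹ * d.F i

/-- The observer gains `L_i = (X_i')⁻¹ U_i`. -/
def L (i : Fin N) : Matrix (Fin n) (Fin (r i)) ℝ := ((d.X i)ᵀ)⁻¹ * d.U i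

/-- `P = (1/N) ∑ᵢ (Y_i⁻¹ + S_i (1 - e^{-2 α_i τ_i}) / (2 α_i))`. -/
def P : Matrix (Fin n) (Fin n) ℝ :=
  (1 / (N : ℝ)) • ∑ i, ((d.Y i)⁻¹ +
    ((1 - Real.exp (-2 * d.α i * net.τ i)) / (2 * d.α i)) • d.S i)

/-- The matrix `Ψ̄_i`. -/
def PsiBar (i : Fin N) : Matrix (Fin (net.p i + 2) × Fin n) (Fin (net.p i + 2) × Fin n) ℝ :=
  RRBlock.PsiBar (net.p i) (d.R i) (d.G i) (d.α i) (net.τ i)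

/-! The blocks of `Ψ̃_i`. -/

def PsiT₁₁ (i : Fin N) : Matrix (Fin n) (Fin n) ℝ :=
  (d.PsiBar net i).submatrix (i₁ _) (i₁ _) - (2 * d.α i) • (d.Y i)⁻¹ - d.S i

def PsiT₁₂ (i : Fin N) : Matrix (Fin n) (Fin (net.p i) × Fin n) ℝ :=
  (d.PsiBar net i).submatrix (i₁ _) (i₂ _)

def PsiT₁₃ (i : Fin N) : Matrix (Fin n) (Fin n) ℝ :=
  (d.PsiBar net i).submatrix (i₁ _) (i₃ _)

def PsiT₂₂ (i : Fin N) : Matrix (Fin (net.p i) × Fin n) (Fin (net.p i) × Fin n) ℝ :=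
  (d.PsiBar net i).submatrix (i₂ _) (i₂ _)

def PsiT₂₃ (i : Fin N) : Matrix (Fin (net.p i) × Fin n) (Fin n) ℝ :=
  (d.PsiBar net i).submatrix (i₂ _) (i₃ _)

def PsiT₃₃ (i : Fin N) : Matrix (Fin n) (Fin n) ℝ :=
  (d.PsiBar net i).submatrix (i₃ _) (i₃ _) + Real.exp (-2 * d.α i * net.τ i) • d.S i

/-! The blocks of `Φ̄_i`; they are indexed by the neighbours of `i`. -/

def Phi₁₁ (i : Fin N) : Matrix (net.nbr i × Fin n) (net.nbr i × Fin n) ℝ :=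
  blkDiag fun j : net.nbr i => d.pi j • (d.Y j)⁻¹ + (Real.pi ^ 2 / 4) • d.W j

def Phi₂₂ (i : Fin N) : Matrix (net.nbr i × Fin n) (net.nbr i × Fin n) ℝ :=
  blkDiag fun j : net.nbr i => (Real.pi ^ 2 / 4) • d.W j

def Phi₁₂ (i : Fin N) : Matrix (net.nbr i × Fin n) (net.nbr i × Fin n) ℝ := - d.Phi₂₂ net i

/-! The blocks of `Ξ̄_i` that are not blocks of `Ψ̃_i` or `Φ̄_i`. -/

def Xi_aa (i : Fin N) : Matrix (Fin n) (Fin n) ℝ :=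
  net.τ i ^ 2 • d.R i + (∑ j ∈ net.outNbr i, net.τ j ^ 2) • d.W i
    - d.ε i • d.X i - d.ε i • (d.X i)ᵀ

def Xi_ab (i : Fin N) : Matrix (Fin n) (Fin n) ℝ :=
  (d.Y i)⁻¹ - d.X i + d.ε i • ((d.X i)ᵀ * net.A - d.U i * net.C i)

def Xi_ac (i : Fin N) : Matrix (Fin n) (Fin (net.p i) × Fin n) ℝ :=
  - d.ε i • oneRow (Fin (net.p i)) (d.F i * net.H i)

def Xi_af (i : Fin N) : Matrix (Fin n) (net.nbr i × Fin n) ℝ :=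
  oneRow (net.nbr i) (- d.εbar i • d.X i + d.ε i • (d.F i * net.H i))

def Xi_ag (i : Fin N) : Matrix (Fin n) (Fin mw ⊕ Fin mv) ℝ :=
  d.ε i • ((d.X i)ᵀ * net.B - d.U i * net.D i)

def Xi_bb (γ : ℝ) (i : Fin N) : Matrix (Fin n) (Fin n) ℝ :=
  (((net.p i : ℝ) + (net.q i : ℝ)) / γ ^ 2) • (1 : Matrix (Fin n) (Fin n) ℝ) - d.PsiT₁₁ net i
    + ((d.X i)ᵀ * net.A - d.U i * net.C i + net.Aᵀ * d.X i - (net.C i)ᵀ * (d.U i)ᵀ)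

def Xi_bc (i : Fin N) : Matrix (Fin n) (Fin (net.p i) × Fin n) ℝ :=
  - d.PsiT₁₂ net i - oneRow (Fin (net.p i)) (d.F i * net.H i)

def Xi_be (γ : ℝ) (i : Fin N) : Matrix (Fin n) (net.nbr i × Fin n) ℝ :=
  - (1 / γ ^ 2) • oneRow (net.nbr i) (1 : Matrix (Fin n) (Fin n) ℝ)

def Xi_bf (i : Fin N) : Matrix (Fin n) (net.nbr i × Fin n) ℝ :=
  oneRow (net.nbr i) (d.F i * net.H i + d.εbar i • (net.Aᵀ * d.X i)
    - d.εbar i • ((net.C i)ᵀ * (d.U i)ᵀ))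

def Xi_bg (i : Fin N) : Matrix (Fin n) (Fin mw ⊕ Fin mv) ℝ :=
  (d.X i)ᵀ * net.B - d.U i * net.D i

def Xi_cf (i : Fin N) : Matrix (Fin (net.p i) × Fin n) (net.nbr i × Fin n) ℝ :=
  - oneFull (Fin (net.p i)) (net.nbr i) (d.εbar i • ((net.H i)ᵀ * (d.F i)ᵀ))

def Xi_ff (i : Fin N) : Matrix (net.nbr i × Fin n) (net.nbr i × Fin n) ℝ :=
  d.εbar i • oneFull (net.nbr i) (net.nbr i) (d.F i * net.H i + (net.H i)ᵀ * (d.F i)ᵀ)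
    - d.Phi₂₂ net i

def Xi_fg (i : Fin N) : Matrix (net.nbr i × Fin n) (Fin mw ⊕ Fin mv) ℝ :=
  d.εbar i • oneCol (net.nbr i) ((d.X i)ᵀ * net.B - d.U i * net.D i)

/-- The matrix `Ξ̄_i`, with seven block rows `a, …, g`, given by its upper triangle. -/
def Xi (γ : ℝ) (i : Fin N) :
    let ι := Fin n ⊕ Fin n ⊕ (Fin (net.p i) × Fin n) ⊕ Fin n ⊕ (net.nbr i × Fin n) ⊕
      (net.nbr i × Fin n) ⊕ (Fin mw ⊕ Fin mv)
    Matrix ι ι ℝ :=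
  sym (d.Xi_aa net i) (fromCols (d.Xi_ab net i) (fromCols (d.Xi_ac net i) (fromCols 0
        (fromCols 0 (fromCols (d.Xi_af net i) (d.Xi_ag net i)))))) <|
  sym (d.Xi_bb net γ i) (fromCols (d.Xi_bc net i) (fromCols (- d.PsiT₁₃ net i)
        (fromCols (Xi_be net γ i) (fromCols (d.Xi_bf net i) (d.Xi_bg net i))))) <|
  sym (- d.PsiT₂₂ net i) (fromCols (- d.PsiT₂₃ net i) (fromCols 0
        (fromCols (d.Xi_cf net i) 0))) <|
  sym (- d.PsiT₃₃ net i) (fromCols 0 (fromCols 0 0)) <|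
  sym (- d.Phi₁₁ net i) (fromCols (- d.Phi₁₂ net i) 0) <|
  sym (d.Xi_ff net i) (d.Xi_fg net i) (-1)

/-- The hypotheses of the synthesis result. The condition `π_i < 2 α_i / q_i` is written as
`q_i π_i < 2 α_i`, so that it is void if `q_i = 0`. -/
def Feasible (γ : ℝ) : Prop :=
  ∀ i, (d.Y i).PosDef ∧ (d.X i).det ≠ 0 ∧ (d.S i).PosSemidef ∧ (d.R i).PosSemidef ∧
    (d.W i).PosSemidef ∧ 0 < d.α i ∧ 0 ≤ d.pi i ∧ (net.q i : ℝ) * d.pi i < 2 * d.α i ∧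
    0 < d.ε i ∧ 0 < d.εbar i ∧
    (fromBlocks (d.R i) (d.G i) (d.G i)ᵀ (d.R i)).PosSemidef ∧
    (- d.Xi net γ i).PosDef

end RRDesign

end

/-!
Write `V_i = e_i' Y_i⁻¹ e_i` and let `f_j` be the sampled and held error of the neighbour `j` that
node `i` has in use. Pairing the error equation with `X_i (e_i + ε_i ė_i + ε̄_i ∑_j f_j)` turns
`Ξ̄_i < 0` into a dissipation inequality for `V_i`, in which the delays enter through three kinds of
terms.
* The terms in `S_i` come from an exponentially weighted integral of `e_i' S_i e_i` over the last
  `τ_i` units of time.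
* The terms in `R_i` and `Ψ̄_i` come from a double integral of `ė_i' R_i ė_i`: the samples in use
  cut the delay window into `p_i + 1` pieces, and Jensen's inequality on each piece and the
  reciprocally convex combination inequality bound the integral over the window below by `Ψ_i`.
* The terms in `W_j` are `τ_i² ė_j' W_j ė_j - (π²/4) (e_j - f_j)' W_j (e_j - f_j)`. Their integral
  is nonnegative by Wirtinger's inequality, since `e_j - f_j` vanishes at every sampling of `j`.

Node `i` also pays `π_j V_j` for each neighbour `j`. Over the whole network this is `q_i π_i V_i`
for each `i`, which the decay `2 α_i V_i` covers. Integrating the sum of the dissipation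
inequalities gives the performance bound, and the strictness of `Ξ̄_i < 0` leaves room for a weight
`e^{2βt}`, which gives exponential stability.
-/

open Set Filter Topology

theorem isSymm_of_posSemidef {ι : Type*} {Q : Matrix ι ι ℝ} (hQ : Q.PosSemidef) : Q.IsSymm :=
  isHermitian_iff_isSymm.1 hQ.isHermitian

section QuadraticForm

variable {ι : Type*} [Fintype ι] {Q : Matrix ι ι ℝ}

theorem dotProduct_mulVec_eq_sum_sum (Q : Matrix ι ι ℝ) (x y : ι → ℝ) :
    x ⬝ᵥ (Q *ᵥ y) = ∑ c, ∑ c', Q c c' * (x c * y c') := by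
  simp only [dotProduct, mulVec, Finset.mul_sum]
  exact Finset.sum_congr rfl fun c _ => Finset.sum_congr rfl fun c' _ => by ring

theorem dotProduct_mulVec_comm_of_isSymm (hQ : Q.IsSymm) (x y : ι → ℝ) :
    y ⬝ᵥ (Q *ᵥ x) = x ⬝ᵥ (Q *ᵥ y) := by
  rw [dotProduct_mulVec, ← mulVec_transpose, hQ, dotProduct_comm]

theorem two_mul_dotProduct_mulVec_eq_sum_sum (hQ : Q.IsSymm) (x y : ι → ℝ) :
    2 * (x ⬝ᵥ (Q *ᵥ y)) = ∑ c, ∑ c', Q c c' * (y c * x c' + x c * y c') := by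
  rw [two_mul]
  nth_rewrite 1 [← dotProduct_mulVec_comm_of_isSymm hQ x y]
  simp only [dotProduct_mulVec_eq_sum_sum, mul_add, Finset.sum_add_distrib]

theorem dotProduct_mulVec_self_nonneg (hQ : Q.PosSemidef) (x : ι → ℝ) : 0 ≤ x ⬝ᵥ (Q *ᵥ x) := by
  simpa only [star_trivial] using hQ.dotProduct_mulVec_nonneg x

theorem two_mul_dotProduct_mulVec_le (hQ : Q.PosSemidef) (x y : ι → ℝ) :
    2 * (x ⬝ᵥ (Q *ᵥ y)) ≤ x ⬝ᵥ (Q *ᵥ x) + y ⬝ᵥ (Q *ᵥ y) := by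
  have h := dotProduct_mulVec_self_nonneg hQ (x - y)
  simp only [mulVec_sub, sub_dotProduct, dotProduct_sub,
    dotProduct_mulVec_comm_of_isSymm (isSymm_of_posSemidef hQ) x y] at h
  linarith

end QuadraticForm

theorem integral_eq_sub_of_absolutelyContinuous_of_ae_hasDerivAt {f f' : ℝ → ℝ} {a b : ℝ}
    (hf : AbsolutelyContinuousOnInterval f a b)
    (hderiv : ∀ᵐ x, x ∈ uIcc a b → HasDerivAt f (f' x) x) :
    ∫ x in a..b, f' x = f b - f a := by
  rw [← hf.integral_deriv_eq_sub]
  refine intervalIntegral.integral_congr_ae ?_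
  filter_upwards [hderiv] with x hx hxm
  exact (hx (uIoc_subset_uIcc hxm)).deriv.symm

theorem absolutelyContinuousOnInterval_of_hasDerivAt {f f' : ℝ → ℝ} {a b : ℝ}
    (hderiv : ∀ x ∈ uIcc a b, HasDerivAt f (f' x) x) (hf' : ContinuousOn f' (uIcc a b)) :
    AbsolutelyContinuousOnInterval f a b := by
  obtain ⟨C, hC⟩ := isCompact_uIcc.exists_bound_of_continuousOn hf'
  refine LipschitzOnWith.absolutelyContinuousOnInterval (K := C.toNNReal) ?_
  refine (convex_uIcc a b).lipschitzOnWith_of_nnnorm_hasDerivWithin_le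
    (fun x hx => (hderiv x hx).hasDerivWithinAt) fun x hx => ?_
  rw [← NNReal.coe_le_coe, coe_nnnorm]
  exact (hC x hx).trans (Real.le_coe_toNNReal C)

theorem intervalIntegrable_sum {κ : Type*} {s : Finset κ} {f : κ → ℝ → ℝ} {a b : ℝ}
    (hf : ∀ i ∈ s, IntervalIntegrable (f i) volume a b) :
    IntervalIntegrable (fun u => ∑ i ∈ s, f i u) volume a b := by
  simpa only [Finset.sum_fn] using IntervalIntegrable.sum s hf

theorem intervalIntegrable_quadratic_of_memLp {ι : Type*} [Fintype ι] {f : ℝ → ι → ℝ} {a b : ℝ}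
    (hf : ∀ c, MemLp (fun u => f u c) 2 (volume.restrict (uIoc a b))) (Q : Matrix ι ι ℝ) :
    IntervalIntegrable (fun u => f u ⬝ᵥ (Q *ᵥ f u)) volume a b := by
  simp only [dotProduct_mulVec_eq_sum_sum]
  exact intervalIntegrable_sum fun c _ => intervalIntegrable_sum fun c' _ =>
    (intervalIntegrable_iff.2 ((hf c).integrable_mul (hf c'))).const_mul (Q c c')

/-- `e` is a primitive of the locally square integrable function `g`, both being vector valued:
the pairs `(e, ė)` to which Wirtinger's and Jensen's inequalities apply. Everything is stated
coordinatewise, so that no norm on `ι → ℝ` enters. -/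
structure HasL2Deriv {ι : Type*} (e g : ℝ → ι → ℝ) : Prop where
  memLp : ∀ c a b, MemLp (fun u => g u c) 2 (volume.restrict (Ioc a b))
  eq : ∀ a b c, e b c - e a c = ∫ u in a..b, g u c

namespace HasL2Deriv

section Coordinates

variable {ι : Type*} {e g : ℝ → ι → ℝ}

theorem intervalIntegrable (hp : HasL2Deriv e g) (c : ι) (a b : ℝ) :
    IntervalIntegrable (fun u => g u c) volume a b :=
  ⟨(hp.memLp c a b).integrable one_le_two, (hp.memLp c b a).integrable one_le_two⟩

theorem eq_add_integral (hp : HasL2Deriv e g) (a : ℝ) (c : ι) :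
    (fun u => e u c) = fun u => e a c + ∫ s in a..u, g s c := by
  funext u
  rw [← hp.eq a u c, add_sub_cancel]

theorem absolutelyContinuousOnInterval (hp : HasL2Deriv e g) (c : ι) (a b : ℝ) :
    AbsolutelyContinuousOnInterval (fun u => e u c) a b := by
  rw [hp.eq_add_integral a c]
  exact contDiffOn_const.absolutelyContinuousOnInterval.add
    ((hp.intervalIntegrable c a b).absolutelyContinuousOnInterval_intervalIntegral left_mem_uIcc)

theorem ae_hasDerivAt (hp : HasL2Deriv e g) (c : ι) (a b : ℝ) :
    ∀ᵐ x, x ∈ uIcc a b → HasDerivAt (fun u => e u c) (g x c) x := by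
  filter_upwards [(hp.intervalIntegrable c a b).ae_hasDerivAt_integral] with x hx hxm
  rw [hp.eq_add_integral a c]
  exact (hx hxm a left_mem_uIcc).const_add _

theorem continuous_apply (hp : HasL2Deriv e g) (c : ι) : Continuous fun u => e u c := by
  rw [hp.eq_add_integral 0 c]
  exact continuous_const.add (intervalIntegral.continuous_primitive (hp.intervalIntegrable c) 0)

theorem continuous (hp : HasL2Deriv e g) : Continuous e :=
  continuous_pi hp.continuous_apply

theorem sub_const (hp : HasL2Deriv e g) (v : ι → ℝ) : HasL2Deriv (fun u => e u - v) g :=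
  ⟨hp.memLp, fun a b c => by
    rw [← hp.eq a b c, Pi.sub_apply, Pi.sub_apply, sub_sub_sub_cancel_right]⟩

variable {φ φ' : ℝ → ℝ} {a b : ℝ}

theorem intervalIntegrable_weighted_mul (hp : HasL2Deriv e g) (hφ : ContinuousOn φ (uIcc a b))
    (hφ' : ContinuousOn φ' (uIcc a b)) (c c' : ι) :
    IntervalIntegrable (fun u => φ' u * (e u c * e u c') +
      φ u * (g u c * e u c' + e u c * g u c')) volume a b := by
  have hc := hp.continuous_apply c
  have hc' := hp.continuous_apply c'
  refine (hφ'.mul (hc.mul hc').continuousOn).intervalIntegrable.add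
    (IntervalIntegrable.continuousOn_mul (.add ?_ ?_) hφ)
  · exact (hp.intervalIntegrable c a b).mul_continuousOn hc'.continuousOn
  · exact (hp.intervalIntegrable c' a b).continuousOn_mul hc.continuousOn

theorem integral_weighted_mul (hp : HasL2Deriv e g)
    (hφ : ∀ x ∈ uIcc a b, HasDerivAt φ (φ' x) x) (hφ' : ContinuousOn φ' (uIcc a b)) (c c' : ι) :
    ∫ u in a..b, (φ' u * (e u c * e u c') + φ u * (g u c * e u c' + e u c * g u c')) =
      φ b * (e b c * e b c') - φ a * (e a c * e a c') := by
  refine integral_eq_sub_of_absolutelyContinuous_of_ae_hasDerivAt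
    (f := fun u => φ u * (e u c * e u c')) ?_ ?_
  · exact (absolutelyContinuousOnInterval_of_hasDerivAt hφ hφ').fun_mul
      ((hp.absolutelyContinuousOnInterval c a b).fun_mul
        (hp.absolutelyContinuousOnInterval c' a b))
  · filter_upwards [hp.ae_hasDerivAt c a b, hp.ae_hasDerivAt c' a b] with x hc hc' hx
    exact (hφ x hx).mul ((hc hx).mul (hc' hx))

end Coordinates

variable {ι : Type*} [Fintype ι] {e g : ℝ → ι → ℝ}

theorem intervalIntegrable_quadratic (hp : HasL2Deriv e g) (Q : Matrix ι ι ℝ) (a b : ℝ) :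
    IntervalIntegrable (fun u => g u ⬝ᵥ (Q *ᵥ g u)) volume a b :=
  intervalIntegrable_quadratic_of_memLp (fun c => hp.memLp c _ _) Q

theorem intervalIntegrable_dotProduct (hp : HasL2Deriv e g) (v : ι → ℝ) (a b : ℝ) :
    IntervalIntegrable (fun u => v ⬝ᵥ g u) volume a b := by
  simp only [dotProduct]
  exact intervalIntegrable_sum fun c _ => (hp.intervalIntegrable c a b).const_mul _

theorem integral_dotProduct (hp : HasL2Deriv e g) (v : ι → ℝ) (a b : ℝ) :
    ∫ u in a..b, v ⬝ᵥ g u = v ⬝ᵥ (e b - e a) := by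
  simp only [dotProduct]
  rw [intervalIntegral.integral_finsetSum
    fun c _ => (hp.intervalIntegrable c a b).const_mul _]
  exact Finset.sum_congr rfl fun c _ => by
    rw [intervalIntegral.integral_const_mul, ← hp.eq a b c, Pi.sub_apply]

theorem intervalIntegrable_bilinear (hp : HasL2Deriv e g) (Q : Matrix ι ι ℝ) {f : ℝ → ι → ℝ}
    (hf : Continuous f) (a b : ℝ) :
    IntervalIntegrable (fun u => f u ⬝ᵥ (Q *ᵥ g u)) volume a b := by
  simp only [dotProduct_mulVec_eq_sum_sum]
  exact intervalIntegrable_sum fun c _ => intervalIntegrable_sum fun c' _ =>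
    ((hp.intervalIntegrable c' a b).continuousOn_mul (by fun_prop)).const_mul _

theorem integral_weighted_quadratic (hp : HasL2Deriv e g) {Q : Matrix ι ι ℝ} (hQ : Q.IsSymm)
    {φ φ' : ℝ → ℝ} {a b : ℝ} (hφ : ∀ x ∈ uIcc a b, HasDerivAt φ (φ' x) x)
    (hφ' : ContinuousOn φ' (uIcc a b)) :
    ∫ u in a..b, (φ' u * (e u ⬝ᵥ (Q *ᵥ e u)) + φ u * (2 * (e u ⬝ᵥ (Q *ᵥ g u)))) =
      φ b * (e b ⬝ᵥ (Q *ᵥ e b)) - φ a * (e a ⬝ᵥ (Q *ᵥ e a)) := by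
  have hφc : ContinuousOn φ (uIcc a b) := fun x hx => (hφ x hx).continuousAt.continuousWithinAt
  have hint : ∀ c c' : ι, IntervalIntegrable (fun u => Q c c' *
      (φ' u * (e u c * e u c') + φ u * (g u c * e u c' + e u c * g u c'))) volume a b :=
    fun c c' => (hp.intervalIntegrable_weighted_mul hφc hφ' c c').const_mul _
  calc _ = ∫ u in a..b, ∑ c, ∑ c', Q c c' *
        (φ' u * (e u c * e u c') + φ u * (g u c * e u c' + e u c * g u c')) := by
        refine intervalIntegral.integral_congr fun u _ => ?_
        simp only [dotProduct_mulVec_eq_sum_sum Q (e u) (e u),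
          two_mul_dotProduct_mulVec_eq_sum_sum hQ (e u) (g u), Finset.mul_sum,
          ← Finset.sum_add_distrib]
        exact Finset.sum_congr rfl fun c _ => Finset.sum_congr rfl fun c' _ => by ring
    _ = ∑ c, ∑ c', Q c c' * (φ b * (e b c * e b c') - φ a * (e a c * e a c')) := by
        rw [intervalIntegral.integral_finsetSum
          fun c _ => intervalIntegrable_sum fun c' _ => hint c c']
        refine Finset.sum_congr rfl fun c _ => ?_
        rw [intervalIntegral.integral_finsetSum fun c' _ => hint c c']
        refine Finset.sum_congr rfl fun c' _ => ?_
        rw [intervalIntegral.integral_const_mul, hp.integral_weighted_mul hφ hφ']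
    _ = _ := by
        simp only [dotProduct_mulVec_eq_sum_sum, Finset.mul_sum, ← Finset.sum_sub_distrib]
        exact Finset.sum_congr rfl fun c _ => Finset.sum_congr rfl fun c' _ => by ring

end HasL2Deriv

theorem hasDerivAt_mul_tan {b c x : ℝ} (hcos : Real.cos (c * (b - x)) ≠ 0) :
    HasDerivAt (fun u => c * Real.tan (c * (b - u)))
      (-c ^ 2 - (c * Real.tan (c * (b - x))) ^ 2) x := by
  have hlin : HasDerivAt (fun u : ℝ => c * (b - u)) (c * -1) x :=
    ((hasDerivAt_id x).const_sub b).const_mul c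
  convert! ((Real.hasDerivAt_tan hcos).comp x hlin).const_mul c using 1
  rw [one_div, ← Real.inv_one_add_tan_sq hcos, inv_inv]
  ring

namespace HasL2Deriv

variable {ι : Type*} [Fintype ι] {e g : ℝ → ι → ℝ}

/-- Completing the square: a solution `φ` of `φ' = -c² - φ²` makes `c² e'We + (φ e'We)'` at most
`g'Wg`, where `g = ė`. -/
theorem integral_quadratic_le_of_riccati (hp : HasL2Deriv e g) {W : Matrix ι ι ℝ}
    (hW : W.PosSemidef) {φ : ℝ → ℝ} {a b c : ℝ} (hab : a ≤ b) (hea : e a = 0) (hφb : φ b = 0)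
    (hφ : ∀ x ∈ uIcc a b, HasDerivAt φ (-c ^ 2 - φ x ^ 2) x) :
    c ^ 2 * ∫ u in a..b, e u ⬝ᵥ (W *ᵥ e u) ≤ ∫ u in a..b, g u ⬝ᵥ (W *ᵥ g u) := by
  have hφc : ContinuousOn φ (uIcc a b) := fun x hx => (hφ x hx).continuousAt.continuousWithinAt
  have hφ'c : ContinuousOn (fun u => -c ^ 2 - φ u ^ 2) (uIcc a b) :=
    continuousOn_const.sub (hφc.pow 2)
  have hftc := hp.integral_weighted_quadratic (isSymm_of_posSemidef hW) hφ hφ'c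
  rw [hea, hφb, zero_mul, zero_dotProduct, mul_zero, sub_zero] at hftc
  have he := hp.continuous
  have hq : Continuous fun u => e u ⬝ᵥ (W *ᵥ e u) := by fun_prop
  have hi : IntervalIntegrable (fun u => c ^ 2 * (e u ⬝ᵥ (W *ᵥ e u))) volume a b :=
    (hq.intervalIntegrable a b).const_mul _
  have hi' : IntervalIntegrable (fun u => (-c ^ 2 - φ u ^ 2) * (e u ⬝ᵥ (W *ᵥ e u)) +
      φ u * (2 * (e u ⬝ᵥ (W *ᵥ g u)))) volume a b :=
    (hφ'c.mul hq.continuousOn).intervalIntegrable.add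
      (((hp.intervalIntegrable_bilinear W he a b).const_mul 2).continuousOn_mul hφc)
  calc _ = ∫ u in a..b, (c ^ 2 * (e u ⬝ᵥ (W *ᵥ e u)) +
        ((-c ^ 2 - φ u ^ 2) * (e u ⬝ᵥ (W *ᵥ e u)) + φ u * (2 * (e u ⬝ᵥ (W *ᵥ g u))))) := by
        rw [intervalIntegral.integral_add hi hi', hftc, add_zero,
          intervalIntegral.integral_const_mul]
    _ ≤ _ := by
        refine intervalIntegral.integral_mono_on hab (hi.add hi')
          (hp.intervalIntegrable_quadratic W a b) fun u _ => ?_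
        have h := two_mul_dotProduct_mulVec_le hW (φ u • e u) (g u)
        simp only [mulVec_smul, smul_dotProduct, dotProduct_smul, smul_eq_mul] at h
        linarith

theorem wirtinger_of_lt (hp : HasL2Deriv e g) {W : Matrix ι ι ℝ} (hW : W.PosSemidef) {a b c : ℝ}
    (hab : a ≤ b) (hc : 0 ≤ c) (hcb : c * (b - a) < Real.pi / 2) :
    c ^ 2 * ∫ u in a..b, (e u - e a) ⬝ᵥ (W *ᵥ (e u - e a)) ≤
      ∫ u in a..b, g u ⬝ᵥ (W *ᵥ g u) := by
  refine (hp.sub_const (e a)).integral_quadratic_le_of_riccati hW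
    (φ := fun u => c * Real.tan (c * (b - u))) hab (sub_self _) (by simp)
    fun x hx => hasDerivAt_mul_tan (Real.cos_pos_of_mem_Ioo ⟨?_, ?_⟩).ne'
  all_goals rw [uIcc_of_le hab] at hx
  · linarith [mul_nonneg hc (sub_nonneg.2 hx.2), Real.pi_pos]
  · exact (mul_le_mul_of_nonneg_left (by linarith [hx.1]) hc).trans_lt hcb

theorem wirtinger_of_le (hp : HasL2Deriv e g) {W : Matrix ι ι ℝ} (hW : W.PosSemidef) {a b c : ℝ}
    (hab : a < b) (hc : 0 < c) (hcb : c * (b - a) ≤ Real.pi / 2) :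
    c ^ 2 * ∫ u in a..b, (e u - e a) ⬝ᵥ (W *ᵥ (e u - e a)) ≤
      ∫ u in a..b, g u ⬝ᵥ (W *ᵥ g u) := by
  have hcont : Continuous fun c : ℝ => c ^ 2 * ∫ u in a..b, (e u - e a) ⬝ᵥ (W *ᵥ (e u - e a)) := by
    fun_prop
  refine le_of_tendsto ((hcont.tendsto c).mono_left (nhdsWithin_le_nhds (s := Iio c))) ?_
  filter_upwards [self_mem_nhdsWithin, mem_nhdsWithin_of_mem_nhds (lt_mem_nhds hc)]
    with c' (hlt : c' < c) (hpos : 0 < c')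
  exact hp.wirtinger_of_lt hW hab.le hpos.le
    ((mul_lt_mul_of_pos_right hlt (sub_pos.2 hab)).trans_le hcb)

theorem wirtinger (hp : HasL2Deriv e g) {W : Matrix ι ι ℝ} (hW : W.PosSemidef) {a b τ : ℝ}
    (hab : a ≤ b) (hτ : b - a ≤ τ) :
    Real.pi ^ 2 / 4 * ∫ u in a..b, (e u - e a) ⬝ᵥ (W *ᵥ (e u - e a)) ≤
      τ ^ 2 * ∫ u in a..b, g u ⬝ᵥ (W *ᵥ g u) := by
  rcases hab.eq_or_lt with rfl | hlt
  · simp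
  have hτ0 : 0 < τ := (sub_pos.2 hlt).trans_le hτ
  have h := hp.wirtinger_of_le hW hlt (c := Real.pi / 2 / τ) (by positivity) <| by
    rw [div_mul_eq_mul_div, div_le_iff₀ hτ0]
    gcongr
  calc _ = τ ^ 2 * ((Real.pi / 2 / τ) ^ 2 *
        ∫ u in a..b, (e u - e a) ⬝ᵥ (W *ᵥ (e u - e a))) := by field_simp; ring
    _ ≤ _ := by gcongr

theorem two_mul_dotProduct_sub_le (hp : HasL2Deriv e g) {R : Matrix ι ι ℝ} {v : ι → ℝ} {κ ω : ℝ}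
    (hv : ∀ x, 2 * (v ⬝ᵥ x) ≤ κ + ω * (x ⬝ᵥ (R *ᵥ x))) {a b : ℝ} (hab : a ≤ b) :
    2 * (v ⬝ᵥ (e b - e a)) ≤ (b - a) * κ + ω * ∫ u in a..b, g u ⬝ᵥ (R *ᵥ g u) := by
  have hR := (hp.intervalIntegrable_quadratic R a b).const_mul ω
  calc 2 * (v ⬝ᵥ (e b - e a)) = ∫ u in a..b, 2 * (v ⬝ᵥ g u) := by
        rw [intervalIntegral.integral_const_mul, hp.integral_dotProduct]
    _ ≤ ∫ u in a..b, (κ + ω * (g u ⬝ᵥ (R *ᵥ g u))) :=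
        intervalIntegral.integral_mono_on hab ((hp.intervalIntegrable_dotProduct v a b).const_mul 2)
          (intervalIntegrable_const.add hR) fun u _ => hv (g u)
    _ = _ := by
        rw [intervalIntegral.integral_add intervalIntegrable_const hR,
          intervalIntegral.integral_const, intervalIntegral.integral_const_mul, smul_eq_mul]

theorem two_mul_sub_dotProduct_mulVec_sub_le (hp : HasL2Deriv e g) {R M : Matrix ι ι ℝ}
    (hM : ∀ x y : ι → ℝ, 2 * (x ⬝ᵥ (M *ᵥ y)) ≤ x ⬝ᵥ (R *ᵥ x) + y ⬝ᵥ (R *ᵥ y))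
    {a b c d : ℝ} (hab : a ≤ b) (hcd : c ≤ d) :
    2 * ((e b - e a) ⬝ᵥ (M *ᵥ (e d - e c))) ≤
      (d - c) * (∫ u in a..b, g u ⬝ᵥ (R *ᵥ g u)) + (b - a) * ∫ u in c..d, g u ⬝ᵥ (R *ᵥ g u) := by
  have hleft (y : ι → ℝ) : 2 * ((e b - e a) ⬝ᵥ (M *ᵥ y)) ≤
      (∫ u in a..b, g u ⬝ᵥ (R *ᵥ g u)) + (b - a) * (y ⬝ᵥ (R *ᵥ y)) := by
    have h := hp.two_mul_dotProduct_sub_le (R := R) (v := M *ᵥ y) (κ := y ⬝ᵥ (R *ᵥ y)) (ω := 1)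
      (fun x => by rw [dotProduct_comm]; linarith [hM x y]) hab
    rw [dotProduct_comm] at h
    linarith
  simp only [dotProduct_mulVec _ M] at hleft ⊢
  exact hp.two_mul_dotProduct_sub_le hleft hcd

theorem sum_integral_quadratic_of_partition (hp : HasL2Deriv e g) (R : Matrix ι ι ℝ) (s : ℕ → ℝ)
    (m : ℕ) : ∑ k ∈ Finset.range m, ∫ u in (s (k + 1))..(s k), g u ⬝ᵥ (R *ᵥ g u) =
      ∫ u in (s m)..(s 0), g u ⬝ᵥ (R *ᵥ g u) := by
  simp only [intervalIntegral.integral_symm (s _) (s (_ + 1)), Finset.sum_neg_distrib]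
  rw [intervalIntegral.sum_integral_adjacent_intervals
    fun k _ => hp.intervalIntegrable_quadratic R (s k) (s (k + 1)),
    ← intervalIntegral.integral_symm]

/-- The combination of Jensen's inequality and the reciprocally convex combination inequality. -/
theorem reciprocally_convex (hp : HasL2Deriv e g) {R M : Matrix ι ι ℝ} (hR : R.PosSemidef)
    (hM : ∀ x y : ι → ℝ, 2 * (x ⬝ᵥ (M *ᵥ y)) ≤ x ⬝ᵥ (R *ᵥ x) + y ⬝ᵥ (R *ᵥ y))
    {s : ℕ → ℝ} {m : ℕ} (hs : ∀ l < m, s (l + 1) ≤ s l) :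
    ∑ k ∈ Finset.range m, ∑ l ∈ Finset.range m,
      (e (s k) - e (s (k + 1))) ⬝ᵥ ((if k = l then R else M) *ᵥ (e (s l) - e (s (l + 1)))) ≤
      (s 0 - s m) * ∫ u in (s m)..(s 0), g u ⬝ᵥ (R *ᵥ g u) := by
  set E : ℕ → ℝ := fun k => ∫ u in (s (k + 1))..(s k), g u ⬝ᵥ (R *ᵥ g u) with hE
  have hpair : ∀ k < m, ∀ l < m,
      (e (s k) - e (s (k + 1))) ⬝ᵥ ((if k = l then R else M) *ᵥ (e (s l) - e (s (l + 1)))) ≤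
      ((s l - s (l + 1)) * E k + (s k - s (k + 1)) * E l) / 2 := by
    intro k hk l hl
    rw [le_div_iff₀ two_pos, mul_comm]
    refine hp.two_mul_sub_dotProduct_mulVec_sub_le ?_ (hs k hk) (hs l hl)
    split_ifs
    exacts [two_mul_dotProduct_mulVec_le hR, hM]
  calc _ ≤ ∑ k ∈ Finset.range m, ∑ l ∈ Finset.range m,
        ((s l - s (l + 1)) * E k + (s k - s (k + 1)) * E l) / 2 :=
        Finset.sum_le_sum fun k hk => Finset.sum_le_sum fun l hl =>
          hpair k (Finset.mem_range.1 hk) l (Finset.mem_range.1 hl)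
    _ = (s 0 - s m) * ∫ u in (s m)..(s 0), g u ⬝ᵥ (R *ᵥ g u) := by
        simp only [← Finset.sum_div, Finset.sum_add_distrib, ← Finset.sum_mul, ← Finset.mul_sum,
          Finset.sum_range_sub' s m, hE, hp.sum_integral_quadratic_of_partition]
        ring

end HasL2Deriv

theorem integral_eq_zero_of_forall_le {f : ℝ → ℝ} {a b : ℝ} (h0 : ∀ u ≤ a, f u = 0)
    (hba : b ≤ a) : ∫ u in a..b, f u = 0 := by
  rw [intervalIntegral.integral_congr (g := fun _ => 0) fun u hu => h0 u ?_,
    intervalIntegral.integral_zero]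
  rw [Set.uIcc_of_ge hba] at hu
  exact hu.2

theorem monotone_integral_of_nonneg {f : ℝ → ℝ} (hf : ∀ u, 0 ≤ f u)
    (hi : ∀ x y, IntervalIntegrable f volume x y) (a : ℝ) :
    Monotone fun t => ∫ u in a..t, f u := fun x y hxy => by
  rw [← sub_nonneg, intervalIntegral.integral_interval_sub_left (hi _ _) (hi _ _)]
  exact intervalIntegral.integral_nonneg hxy fun u _ => hf u

theorem integral_sub_shift_le {F : ℝ → ℝ} (hF : Monotone F) (hc : Continuous F) {a T τ : ℝ}
    (h0 : ∀ u ≤ a, F u = 0) (hτ : 0 ≤ τ) :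
    ∫ u in a..T, (F u - F (u - τ)) ≤ τ * F T := by
  have hi : ∀ x y, IntervalIntegrable F volume x y := hc.intervalIntegrable
  have hs : Continuous fun u => F (u - τ) := hc.comp (continuous_sub_right τ)
  have hlast : ∫ u in (T - τ)..T, F u ≤ ∫ _ in (T - τ)..T, F T :=
    intervalIntegral.integral_mono_on (by linarith) (hi _ _) intervalIntegrable_const
      fun u hu => hF hu.2
  rw [intervalIntegral.integral_const, smul_eq_mul, sub_sub_cancel] at hlast
  rw [intervalIntegral.integral_sub (hi _ _) (hs.intervalIntegrable _ _),
    intervalIntegral.integral_comp_sub_right (fun u => F u),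
    intervalIntegral.integral_interval_sub_interval_comm (hi _ _) (hi _ _) (hi _ _),
    integral_eq_zero_of_forall_le h0 (sub_le_self a hτ), intervalIntegral.integral_symm (T - τ)]
  linarith

theorem continuous_integral_delay {ρ : ℝ → ℝ} (hi : ∀ x y, IntervalIntegrable ρ volume x y)
    (τ : ℝ) : Continuous fun u => ∫ s in (u - τ)..u, ρ s := by
  have hsplit : (fun u => ∫ s in (u - τ)..u, ρ s) =
      fun u => (∫ s in (0 : ℝ)..u, ρ s) - ∫ s in (0 : ℝ)..(u - τ), ρ s := by
    funext u
    exact (intervalIntegral.integral_interval_sub_left (hi _ _) (hi _ _)).symm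
  have hprim := intervalIntegral.continuous_primitive hi 0
  rw [hsplit]
  exact hprim.sub (hprim.comp (continuous_sub_right τ))

theorem intervalIntegrable_exp_mul {ρ : ℝ → ℝ} {x y : ℝ} (hi : IntervalIntegrable ρ volume x y)
    (c : ℝ) : IntervalIntegrable (fun u => Real.exp (c * u) * ρ u) volume x y :=
  hi.continuousOn_mul (by fun_prop)

theorem exp_mul_integral_delay_le {ρ : ℝ → ℝ} (hρ : ∀ u, 0 ≤ ρ u) {τ β : ℝ}
    (hi : ∀ x y, IntervalIntegrable ρ volume x y) (hτ : 0 ≤ τ) (hβ : 0 ≤ β) (u : ℝ) :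
    Real.exp (2 * β * u) * ∫ s in (u - τ)..u, ρ s ≤
      Real.exp (2 * β * τ) * ∫ s in (u - τ)..u, Real.exp (2 * β * s) * ρ s := by
  rw [← intervalIntegral.integral_const_mul, ← intervalIntegral.integral_const_mul]
  refine intervalIntegral.integral_mono_on (by linarith) ((hi _ _).const_mul _)
    ((intervalIntegrable_exp_mul (hi _ _) _).const_mul _) fun s hs => ?_
  rw [← mul_assoc, ← Real.exp_add]
  refine mul_le_mul_of_nonneg_right (Real.exp_le_exp.2 ?_) (hρ s)
  nlinarith [hs.1]

theorem integral_weighted_delay_le {ρ : ℝ → ℝ} (hρ : ∀ u, 0 ≤ ρ u) {a T τ β : ℝ}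
    (hi : ∀ x y, IntervalIntegrable ρ volume x y) (h0 : ∀ u ≤ a, ρ u = 0) (haT : a ≤ T)
    (hτ : 0 ≤ τ) (hβ : 0 ≤ β) :
    ∫ u in a..T, Real.exp (2 * β * u) * ∫ s in (u - τ)..u, ρ s ≤
      Real.exp (2 * β * τ) * (τ * ∫ u in a..T, Real.exp (2 * β * u) * ρ u) := by
  have hiw : ∀ x y, IntervalIntegrable (fun u => Real.exp (2 * β * u) * ρ u) volume x y :=
    fun x y => intervalIntegrable_exp_mul (hi x y) _
  set F : ℝ → ℝ := fun t => ∫ u in a..t, Real.exp (2 * β * u) * ρ u with hF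
  have hFc : Continuous F := intervalIntegral.continuous_primitive hiw a
  have hFm : Monotone F :=
    monotone_integral_of_nonneg (fun u => mul_nonneg (Real.exp_pos _).le (hρ u)) hiw a
  have hF0 : ∀ u ≤ a, F u = 0 := fun u hu =>
    integral_eq_zero_of_forall_le (fun s hs => by rw [h0 s hs, mul_zero]) hu
  calc ∫ u in a..T, Real.exp (2 * β * u) * ∫ s in (u - τ)..u, ρ s
      ≤ ∫ u in a..T, Real.exp (2 * β * τ) * (F u - F (u - τ)) := by
        refine intervalIntegral.integral_mono_on haT
          (intervalIntegrable_exp_mul ((continuous_integral_delay hi τ).intervalIntegrable _ _) _)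
          (Continuous.intervalIntegrable (by fun_prop) _ _) fun u _ => ?_
        rw [hF, intervalIntegral.integral_interval_sub_left (hiw _ _) (hiw _ _)]
        exact exp_mul_integral_delay_le hρ hi hτ hβ u
    _ = Real.exp (2 * β * τ) * ∫ u in a..T, (F u - F (u - τ)) :=
        intervalIntegral.integral_const_mul _ _
    _ ≤ Real.exp (2 * β * τ) * (τ * F T) :=
        mul_le_mul_of_nonneg_left (integral_sub_shift_le hFm hFc hF0 hτ) (Real.exp_pos _).le

theorem neg_mul_integral_le_integral_sub_shift {w : ℝ → ℝ} (hw : Continuous w)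
    (hw0 : ∀ u, 0 ≤ w u) {a T τ κ : ℝ} (haT : a ≤ T) (hτ : 0 ≤ τ) (hκ0 : 0 ≤ κ) (hκ1 : κ ≤ 1) :
    -(κ * ∫ u in (a - τ)..a, w u) ≤ ∫ u in a..T, (w u - κ * w (u - τ)) := by
  have hi : ∀ x y, IntervalIntegrable w volume x y := hw.intervalIntegrable
  have hs : Continuous fun u => κ * w (u - τ) := by fun_prop
  have hnonneg : ∀ x y, x ≤ y → 0 ≤ ∫ u in x..y, w u := fun x y hxy =>
    intervalIntegral.integral_nonneg hxy fun u _ => hw0 u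
  have hshift : ∫ u in (a - τ)..(T - τ), w u ≤ (∫ u in (a - τ)..a, w u) + ∫ u in a..T, w u := by
    rw [intervalIntegral.integral_add_adjacent_intervals (hi _ _) (hi _ _),
      ← intervalIntegral.integral_add_adjacent_intervals (hi (a - τ) (T - τ)) (hi _ T)]
    exact le_add_of_nonneg_right (hnonneg _ _ (sub_le_self T hτ))
  rw [intervalIntegral.integral_sub (hi _ _) (hs.intervalIntegrable _ _),
    intervalIntegral.integral_const_mul, intervalIntegral.integral_comp_sub_right (fun u => w u)]
  nlinarith [mul_le_mul_of_nonneg_left hshift hκ0,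
    mul_nonneg (sub_nonneg.2 hκ1) (hnonneg a T haT)]

theorem integral_weighted_sub_delay_ge {σ : ℝ → ℝ} (hσ : ∀ u, 0 ≤ σ u) (hc : Continuous σ)
    {a T τ α β σ₀ : ℝ} (h0 : ∀ u ≤ a, σ u = σ₀) (haT : a ≤ T) (hτ : 0 ≤ τ) (hβ : 0 ≤ β)
    (hβα : β ≤ α) :
    -(Real.exp (-2 * (α - β) * τ) * (τ * (Real.exp (2 * β * a) * σ₀))) ≤
      ∫ u in a..T, Real.exp (2 * β * u) * (σ u - Real.exp (-2 * α * τ) * σ (u - τ)) := by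
  set w : ℝ → ℝ := fun u => Real.exp (2 * β * u) * σ u with hw
  have hwc : Continuous w := by fun_prop
  have hσ₀ : 0 ≤ σ₀ := h0 a le_rfl ▸ hσ a
  have hκ1 : Real.exp (-2 * (α - β) * τ) ≤ 1 :=
    Real.exp_le_one_iff.2 (by nlinarith [mul_nonneg (sub_nonneg.2 hβα) hτ])
  have hintegrand : ∀ u, Real.exp (2 * β * u) * (σ u - Real.exp (-2 * α * τ) * σ (u - τ)) =
      w u - Real.exp (-2 * (α - β) * τ) * w (u - τ) := fun u => by
    rw [hw, ← mul_assoc (Real.exp (-2 * (α - β) * τ)), ← Real.exp_add, mul_sub, ← mul_assoc,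
      ← Real.exp_add]
    congr 3
    ring
  have hpast : ∫ u in (a - τ)..a, w u ≤ τ * (Real.exp (2 * β * a) * σ₀) := by
    have hle := intervalIntegral.integral_mono_on (sub_le_self a hτ)
      (hwc.intervalIntegrable _ _)
      (intervalIntegrable_const (μ := volume) (c := Real.exp (2 * β * a) * σ₀)) fun u hu => by
        change Real.exp (2 * β * u) * σ u ≤ _
        rw [h0 u hu.2]
        exact mul_le_mul_of_nonneg_right (Real.exp_le_exp.2 (by nlinarith [hu.2])) hσ₀
    rwa [intervalIntegral.integral_const, smul_eq_mul, sub_sub_cancel] at hle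
  simp only [hintegrand]
  refine le_trans (neg_le_neg (mul_le_mul_of_nonneg_left hpast (Real.exp_pos _).le)) ?_
  exact neg_mul_integral_le_integral_sub_shift hwc
    (fun u => mul_nonneg (Real.exp_pos _).le (hσ u)) haT hτ (Real.exp_pos _).le hκ1

namespace RRNetwork

section Shift

variable {α : Type*}

theorem shift_perm (l : List α) : (shift l).Perm l := List.rotate_perm _ _

theorem shift_append_singleton (l : List α) (b : α) : shift (l ++ [b]) = b :: l := by
  rw [shift, List.length_append, List.length_singleton, Nat.add_sub_cancel,
    List.rotate_append_length_eq, List.singleton_append]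

theorem idxOf_shift [DecidableEq α] {l : List α} {j : α} (hj : j ∈ l) :
    (shift l).idxOf j = l.idxOf j + 1 ∨ (shift l).idxOf j = 0 := by
  obtain ⟨l', b, rfl⟩ := (List.eq_nil_or_concat' l).resolve_left (List.ne_nil_of_mem hj)
  rw [shift_append_singleton]
  by_cases hb : b = j
  · exact .inr (hb ▸ List.idxOf_cons_self)
  · have hj' : j ∈ l' := (List.mem_append.1 hj).resolve_right fun h =>
      hb (List.mem_singleton.1 h).symm
    exact .inl (by rw [List.idxOf_cons_ne _ hb, List.idxOf_append_of_mem hj'])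

end Shift

variable {N n mw mv : ℕ} {r h : Fin N → ℕ} (net : RRNetwork N n mw mv r h)

section Schedule

variable {i j : Fin N}

theorem polling_succ (i : Fin N) (k : ℕ) : net.polling i (k + 1) = shift (net.polling i k) :=
  Function.iterate_succ_apply' _ _ _

theorem polling_perm (i : Fin N) (k : ℕ) :
    (net.polling i k).Perm ((net.nbr i).sort (· ≤ ·)) := by
  induction k with
  | zero => exact List.Perm.refl _
  | succ k ih => rw [polling_succ]; exact (shift_perm _).trans ih

theorem mem_polling {k : ℕ} : j ∈ net.polling i k ↔ j ∈ net.nbr i := by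
  rw [(net.polling_perm i k).mem_iff, Finset.mem_sort]

theorem length_polling (i : Fin N) (k : ℕ) : (net.polling i k).length = net.p i := by
  rw [(net.polling_perm i k).length_eq, Finset.length_sort, p]

theorem nodup_polling (i : Fin N) (k : ℕ) : (net.polling i k).Nodup :=
  (net.polling_perm i k).nodup_iff.2 (Finset.sort_nodup _ _)

theorem idxOf_polling_lt (hj : j ∈ net.nbr i) (k : ℕ) : (net.polling i k).idxOf j < net.p i :=
  net.length_polling i k ▸ List.idxOf_lt_length_of_mem (net.mem_polling.2 hj)

theorem sampleTime_eq (i j : Fin N) (k : ℕ) :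
    net.sampleTime i k j = net.t (k - (net.polling i k).idxOf j) := by
  rw [sampleTime, ν, Nat.add_sub_add_right]

theorem sampleTime_succ (hj : j ∈ net.nbr i) (k : ℕ) :
    net.sampleTime i (k + 1) j = net.sampleTime i k j ∨
      net.sampleTime i (k + 1) j = net.t (k + 1) := by
  rw [sampleTime_eq, sampleTime_eq, polling_succ]
  rcases idxOf_shift (net.mem_polling (k := k) |>.2 hj) with h | h
  · left; rw [h, Nat.add_sub_add_right]
  · right; rw [h, Nat.sub_zero]

theorem sum_sampleTime (i : Fin N) (k : ℕ) {M : Type*} [AddCommMonoid M] (f : ℝ → M) :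
    ∑ j ∈ net.nbr i, f (net.sampleTime i k j) =
      ∑ l ∈ Finset.range (net.p i), f (net.t (k - l)) := by
  refine Finset.sum_nbij (fun j => (net.polling i k).idxOf j) ?_ ?_ ?_ ?_
  · intro j hj
    exact Finset.mem_range.2 (net.idxOf_polling_lt hj k)
  · intro j hj j' _ hjj'
    exact (List.idxOf_inj (net.mem_polling.2 hj)).1 hjj'
  · intro l hl
    have hl' : l < (net.polling i k).length := by
      rw [length_polling]; exact Finset.mem_range.1 hl
    exact ⟨(net.polling i k)[l], net.mem_polling.1 (List.getElem_mem hl'),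
      (net.nodup_polling i k).idxOf_getElem l hl'⟩
  · intro j _
    simp only [sampleTime_eq]

theorem sampleTime_le (i j : Fin N) (k : ℕ) : net.sampleTime i k j ≤ net.t k := by
  rw [sampleTime_eq]
  exact net.t_strictMono.monotone (Nat.sub_le _ _)

theorem t_nonneg (k : ℕ) : 0 ≤ net.t k :=
  net.t_zero ▸ net.t_strictMono.monotone (Nat.zero_le k)

theorem pollGap_nonneg (i : Fin N) (k : ℕ) : 0 ≤ net.pollGap i k :=
  sub_nonneg.2 (net.t_strictMono.monotone (Nat.sub_le _ _))

theorem τ_nonneg (i : Fin N) : 0 ≤ net.τ i := Real.iSup_nonneg (net.pollGap_nonneg i)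

theorem sub_le_τ (hτ : BddAbove (range (net.pollGap i))) (k : ℕ) :
    net.t (k + 1) - net.t (k + 1 - net.p i) ≤ net.τ i :=
  le_ciSup hτ k

theorem sub_sampleTime_le (hτ : BddAbove (range (net.pollGap i))) (hj : j ∈ net.nbr i) (k : ℕ) :
    net.t (k + 1) - net.sampleTime i k j ≤ net.τ i := by
  refine le_trans ?_ (net.sub_le_τ hτ k)
  rw [sampleTime_eq]
  have := net.idxOf_polling_lt hj k
  exact sub_le_sub_left (net.t_strictMono.monotone (by omega)) _

end Schedule

section SamplingIndex

theorem exists_lt_t_succ (u : ℝ) : ∃ k, u < net.t (k + 1) :=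
  ((net.t_tendsto.comp (tendsto_add_atTop_nat 1)).eventually_gt_atTop u).exists

open Classical in
/-- The index `k` of the sampling interval `[t_k, t_{k+1})` that contains `u`; it is `0` for
negative `u`. -/
noncomputable def idx (u : ℝ) : ℕ := Nat.find (net.exists_lt_t_succ u)

theorem lt_t_idx_succ (u : ℝ) : u < net.t (net.idx u + 1) := by
  classical exact Nat.find_spec (net.exists_lt_t_succ u)

theorem t_idx_le {u : ℝ} (hu : 0 ≤ u) : net.t (net.idx u) ≤ u := by
  classical
  rcases hk : net.idx u with _ | k
  · rwa [net.t_zero]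
  · have hlt : k < net.idx u := hk ▸ k.lt_succ_self
    exact not_lt.1 (Nat.find_min (net.exists_lt_t_succ u) hlt)

theorem le_idx {m : ℕ} {u : ℝ} (hu : net.t m ≤ u) : m ≤ net.idx u :=
  Nat.lt_succ_iff.1 (net.t_strictMono.lt_iff_lt.1 (hu.trans_lt (net.lt_t_idx_succ u)))

theorem idx_eq {k : ℕ} {u : ℝ} (hk : net.t k ≤ u) (hk' : u < net.t (k + 1)) : net.idx u = k := by
  have hle : net.t (net.idx u) ≤ u := net.t_idx_le ((net.t_nonneg k).trans hk)
  exact le_antisymm (Nat.lt_succ_iff.1 (net.t_strictMono.lt_iff_lt.1 (hle.trans_lt hk')))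
    (net.le_idx hk)

theorem idx_mono : Monotone net.idx := by
  intro u v huv
  classical exact Nat.find_mono fun k hk => huv.trans_lt hk

end SamplingIndex

end RRNetwork

theorem memLp_two_of_bound {f : ℝ → ℝ} (hf : Measurable f) {a b C : ℝ}
    (hC : ∀ u ∈ Ioc a b, |f u| ≤ C) : MemLp f 2 (volume.restrict (Ioc a b)) :=
  .of_bound hf.aestronglyMeasurable C ((ae_restrict_iff' measurableSet_Ioc).2 (.of_forall hC))

theorem memLp_two_restrict_Ioc_of_continuous {f : ℝ → ℝ} (hf : Continuous f) (a b : ℝ) :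
    MemLp f 2 (volume.restrict (Ioc a b)) := by
  obtain ⟨C, hC⟩ := (isCompact_Icc (a := a) (b := b)).exists_bound_of_continuousOn hf.continuousOn
  exact memLp_two_of_bound hf.measurable fun u hu => hC u (Ioc_subset_Icc_self hu)

theorem memLp_mulVec {ι κ : Type*} [Fintype κ] (M : Matrix ι κ ℝ) {f : ℝ → κ → ℝ}
    {μ : Measure ℝ} (hf : ∀ d, MemLp (fun u => f u d) 2 μ) (c : ι) :
    MemLp (fun u => (M *ᵥ f u) c) 2 μ := by
  simp only [mulVec, dotProduct]
  exact memLp_finsetSum _ fun d _ => (hf d).const_mul (M c d)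

theorem eq_add_integral_of_forall_Icc {f g : ℝ → ℝ} {t : ℕ → ℝ} (ht : Monotone t)
    (hi : ∀ a b, IntervalIntegrable g volume a b) {m : ℕ}
    (hf : ∀ k ≥ m, ∀ s ∈ Icc (t k) (t (k + 1)), f s = f (t k) + ∫ u in (t k)..s, g u)
    {k : ℕ} (hk : m ≤ k) {s : ℝ} (hs : s ∈ Icc (t k) (t (k + 1))) :
    f s = f (t m) + ∫ u in (t m)..s, g u := by
  have hnode : f (t k) = f (t m) + ∫ u in (t m)..(t k), g u := by
    clear hs
    induction k, hk using Nat.le_induction with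
    | base => rw [intervalIntegral.integral_same, add_zero]
    | succ k hk ih =>
      rw [hf k hk _ (right_mem_Icc.2 (ht k.le_succ)), ih, add_assoc,
        intervalIntegral.integral_add_adjacent_intervals (hi _ _) (hi _ _)]
  rw [hf k hk s hs, hnode, add_assoc,
    intervalIntegral.integral_add_adjacent_intervals (hi _ _) (hi _ _)]

namespace RRNetwork

variable {N n mw mv : ℕ} {r h : Fin N → ℕ} (net : RRNetwork N n mw mv r h)

/-- The value of the signal `f` that is in use on the channel `(j, i)` at time `u`. -/
noncomputable def held (f : ℝ → Fin n → ℝ) (i j : Fin N) (u : ℝ) : Fin n → ℝ :=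
  f (net.sampleTime i (net.idx u) j)

theorem measurable_held (f : ℝ → Fin n → ℝ) (i j : Fin N) (c : Fin n) :
    Measurable fun u => net.held f i j u c :=
  (measurable_from_nat (f := fun k => f (net.sampleTime i k j) c)).comp net.idx_mono.measurable

theorem memLp_held (f : ℝ → Fin n → ℝ) (i j : Fin N) (c : Fin n) (a b : ℝ) :
    MemLp (fun u => net.held f i j u c) 2 (volume.restrict (Ioc a b)) := by
  refine memLp_two_of_bound (net.measurable_held f i j c)
    (C := ∑ k ∈ Finset.range (net.idx b + 1), |f (net.sampleTime i k j) c|) fun u hu => ?_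
  exact Finset.single_le_sum (f := fun k => |f (net.sampleTime i k j) c|)
    (fun _ _ => abs_nonneg _) (Finset.mem_range_succ_iff.2 (net.idx_mono hu.2))

/-- The right-hand side of the error equation of node `i`, extended by zero to the times before the
initial time `t_m`, where the error is constant. -/
noncomputable def errorRate (K : ∀ i, Matrix (Fin n) (Fin (h i)) ℝ)
    (L : ∀ i, Matrix (Fin n) (Fin (r i)) ℝ) (ξ : Fin N → ℝ → (Fin mw ⊕ Fin mv) → ℝ) (m : ℕ)
    (e : Fin N → ℝ → Fin n → ℝ) (i : Fin N) : ℝ → Fin n → ℝ :=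
  (Ioi (net.t m)).indicator fun u =>
    (net.A - L i * net.C i) *ᵥ e i u + (net.B - L i * net.D i) *ᵥ ξ i u +
      (K i * net.H i) *ᵥ ∑ j ∈ net.nbr i, (net.held (e j) i j u - net.held (e i) i j u)

variable {net} {K : ∀ i, Matrix (Fin n) (Fin (h i)) ℝ} {L : ∀ i, Matrix (Fin n) (Fin (r i)) ℝ}
  {ξ : Fin N → ℝ → (Fin mw ⊕ Fin mv) → ℝ} {m : ℕ} {φ : Fin N → Fin n → ℝ}
  {e : Fin N → ℝ → Fin n → ℝ}

theorem errorRate_of_le {u : ℝ} (hu : u ≤ net.t m) (i : Fin N) :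
    net.errorRate K L ξ m e i u = 0 :=
  indicator_of_notMem (notMem_Ioi.2 hu) _

theorem errorRate_of_lt {u : ℝ} (hu : net.t m < u) (i : Fin N) :
    net.errorRate K L ξ m e i u =
      (net.A - L i * net.C i) *ᵥ e i u + (net.B - L i * net.D i) *ᵥ ξ i u +
      (K i * net.H i) *ᵥ ∑ j ∈ net.nbr i, (net.held (e j) i j u - net.held (e i) i j u) :=
  indicator_of_mem (mem_Ioi.2 hu) _

theorem memLp_errorRate (he : ∀ i, Continuous (e i))
    (hξ : ∀ i c, MemLp (fun u => ξ i u c) 2 (volume.restrict (Ioi (net.t m))))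
    (i : Fin N) (c : Fin n) (a b : ℝ) :
    MemLp (fun u => net.errorRate K L ξ m e i u c) 2 (volume.restrict (Ioc a b)) := by
  have hcoord : (fun u => net.errorRate K L ξ m e i u c) = (Ioi (net.t m)).indicator fun u =>
      ((net.A - L i * net.C i) *ᵥ e i u) c + ((net.B - L i * net.D i) *ᵥ ξ i u) c +
      ((K i * net.H i) *ᵥ ∑ j ∈ net.nbr i, (net.held (e j) i j u - net.held (e i) i j u)) c := by
    funext u
    by_cases hu : u ∈ Ioi (net.t m) <;> simp [errorRate, hu]
  rw [hcoord, memLp_indicator_iff_restrict measurableSet_Ioi,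
    Measure.restrict_restrict measurableSet_Ioi]
  have hIoc : volume.restrict (Ioi (net.t m) ∩ Ioc a b) ≤ volume.restrict (Ioc a b) :=
    Measure.restrict_mono inter_subset_right le_rfl
  have hIoi : volume.restrict (Ioi (net.t m) ∩ Ioc a b) ≤ volume.restrict (Ioi (net.t m)) :=
    Measure.restrict_mono inter_subset_left le_rfl
  refine ((memLp_mulVec _ (fun d => ?_) c).add
    (memLp_mulVec _ (fun d => (hξ i d).mono_measure hIoi) c)).add (memLp_mulVec _ (fun d => ?_) c)
  · exact (memLp_two_restrict_Ioc_of_continuous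
      ((continuous_apply d).comp (he i)) a b).mono_measure hIoc
  · simp only [Finset.sum_apply, Pi.sub_apply]
    exact memLp_finsetSum _ fun j _ => ((net.memLp_held (e j) i j d a b).mono_measure hIoc).sub
      ((net.memLp_held (e i) i j d a b).mono_measure hIoc)

theorem intervalIntegrable_errorRate (he : ∀ i, Continuous (e i))
    (hξ : ∀ i c, MemLp (fun u => ξ i u c) 2 (volume.restrict (Ioi (net.t m))))
    (i : Fin N) (c : Fin n) (a b : ℝ) :
    IntervalIntegrable (fun u => net.errorRate K L ξ m e i u c) volume a b :=
  ⟨(memLp_errorRate he hξ i c a b).integrable one_le_two,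
    (memLp_errorRate he hξ i c b a).integrable one_le_two⟩

theorem IsErrorTrajectory.eq_add_integral_errorRate (he : net.IsErrorTrajectory K L ξ m φ e)
    (hξ : ∀ i c, MemLp (fun u => ξ i u c) 2 (volume.restrict (Ioi (net.t m)))) (i : Fin N)
    (c : Fin n) {k : ℕ} (hk : m ≤ k) {s : ℝ} (hs : s ∈ Icc (net.t k) (net.t (k + 1))) :
    e i s c = e i (net.t k) c + ∫ u in (net.t k)..s, net.errorRate K L ξ m e i u c := by
  have hrate : (∫ u in (net.t k)..s, ((net.A - L i * net.C i) *ᵥ e i u +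
      (net.B - L i * net.D i) *ᵥ ξ i u + (K i * net.H i) *ᵥ ∑ j ∈ net.nbr i,
          (e j (net.sampleTime i k j) - e i (net.sampleTime i k j)))) =
      ∫ u in (net.t k)..s, net.errorRate K L ξ m e i u := by
    rw [intervalIntegral.integral_of_le hs.1, intervalIntegral.integral_of_le hs.1,
      integral_Ioc_eq_integral_Ioo, integral_Ioc_eq_integral_Ioo]
    refine setIntegral_congr_fun measurableSet_Ioo fun u hu => ?_
    have hidx : net.idx u = k := net.idx_eq hu.1.le (hu.2.trans_le hs.2)
    simp only [errorRate_of_lt ((net.t_strictMono.monotone hk).trans_lt hu.1), held, hidx]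
  rw [he.2.2 i k hk s hs, hrate, Pi.add_apply, intervalIntegral.integral_of_le hs.1,
    intervalIntegral.integral_of_le hs.1,
    eval_integral fun c' => (intervalIntegrable_errorRate he.1 hξ i c' _ _).1]

theorem IsErrorTrajectory.hasL2Deriv (he : net.IsErrorTrajectory K L ξ m φ e)
    (hξ : ∀ i c, MemLp (fun u => ξ i u c) 2 (volume.restrict (Ioi (net.t m)))) (i : Fin N) :
    HasL2Deriv (e i) (net.errorRate K L ξ m e i) := by
  have hint := intervalIntegrable_errorRate (K := K) (L := L) he.1 hξ i
  have hfrom : ∀ c s,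
      e i s c = e i (net.t m) c + ∫ u in (net.t m)..s, net.errorRate K L ξ m e i u c := by
    intro c s
    rcases le_total s (net.t m) with hs | hs
    · rw [he.2.1 i s hs, he.2.1 i _ le_rfl, integral_eq_zero_of_forall_le
        (fun u hu => congrFun (errorRate_of_le hu i) c) hs, add_zero]
    · exact eq_add_integral_of_forall_Icc (f := fun u => e i u c) net.t_strictMono.monotone
        (hint c) (fun k hk s hs => he.eq_add_integral_errorRate hξ i c hk hs) (net.le_idx hs)
        ⟨net.t_idx_le ((net.t_nonneg m).trans hs), (net.lt_t_idx_succ s).le⟩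
  refine ⟨memLp_errorRate he.1 hξ i, fun a b c => ?_⟩
  rw [hfrom c a, hfrom c b, add_sub_add_left_eq_sub,
    intervalIntegral.integral_interval_sub_left (hint _ _ _) (hint _ _ _)]

end RRNetwork

namespace RRBlock

variable {ι κ α β : Type*}

theorem sym_quadratic [Fintype α] [Fintype β] (M₁₁ : Matrix α α ℝ) (M₁₂ : Matrix α β ℝ)
    (M₂₂ : Matrix β β ℝ) (x : α → ℝ) (y : β → ℝ) :
    Sum.elim x y ⬝ᵥ (sym M₁₁ M₁₂ M₂₂ *ᵥ Sum.elim x y) =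
      x ⬝ᵥ (M₁₁ *ᵥ x) + 2 * (x ⬝ᵥ (M₁₂ *ᵥ y)) + y ⬝ᵥ (M₂₂ *ᵥ y) := by
  have h : sym M₁₁ M₁₂ M₂₂ *ᵥ Sum.elim x y =
      Sum.elim (M₁₁ *ᵥ x + M₁₂ *ᵥ y) (M₁₂ᵀ *ᵥ x + M₂₂ *ᵥ y) := by
    rw [sym, fromBlocks_mulVec]
    rfl
  rw [h, sumElim_dotProduct_sumElim, dotProduct_add, dotProduct_add, dotProduct_transpose_mulVec]
  ring

theorem fromCols_mulVec_elim [Fintype α] [Fintype β] (M₁ : Matrix κ α ℝ) (M₂ : Matrix κ β ℝ)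
    (x : α → ℝ) (y : β → ℝ) :
    fromCols M₁ M₂ *ᵥ Sum.elim x y = M₁ *ᵥ x + M₂ *ᵥ y := by
  rw [fromCols_mulVec]
  rfl

theorem oneRow_mulVec [Fintype ι] [Fintype β] (M : Matrix α β ℝ) (x : ι → β → ℝ) :
    oneRow ι M *ᵥ Function.uncurry x = M *ᵥ ∑ l, x l := by
  ext a
  simp only [oneRow, mulVec, dotProduct, of_apply, Fintype.sum_prod_type, Function.uncurry,
    Finset.sum_apply, Finset.mul_sum]
  exact Finset.sum_comm

variable [Fintype ι] [Fintype α]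

theorem dotProduct_oneFull_mulVec [Fintype κ] [Fintype β] (M : Matrix α β ℝ) (x : ι → α → ℝ)
    (y : κ → β → ℝ) :
    Function.uncurry x ⬝ᵥ (oneFull ι κ M *ᵥ Function.uncurry y) =
      (∑ l, x l) ⬝ᵥ (M *ᵥ ∑ j, y j) := by
  have h : oneFull ι κ M *ᵥ Function.uncurry y = fun a => (M *ᵥ ∑ j, y j) a.2 := by
    funext a
    exact congrFun (oneRow_mulVec M y) a.2
  rw [h]
  simp only [dotProduct, Fintype.sum_prod_type, Function.uncurry, Finset.sum_apply, Finset.sum_mul]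
  exact Finset.sum_comm

theorem dotProduct_oneCol_mulVec [Fintype β] (M : Matrix α β ℝ) (x : ι → α → ℝ) (y : β → ℝ) :
    Function.uncurry x ⬝ᵥ (oneCol ι M *ᵥ y) = (∑ l, x l) ⬝ᵥ (M *ᵥ y) := by
  have h : oneCol ι M *ᵥ y = fun a => (M *ᵥ y) a.2 := rfl
  rw [h]
  simp only [dotProduct, Fintype.sum_prod_type, Function.uncurry, Finset.sum_apply, Finset.sum_mul]
  exact Finset.sum_comm

theorem dotProduct_blkDiag_mulVec [DecidableEq ι] (M : ι → Matrix α α ℝ) (x y : ι → α → ℝ) :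
    Function.uncurry x ⬝ᵥ (blkDiag M *ᵥ Function.uncurry y) = ∑ j, x j ⬝ᵥ (M j *ᵥ y j) := by
  have h : blkDiag M *ᵥ Function.uncurry y = Function.uncurry fun j => M j *ᵥ y j := by
    funext a
    simp [blkDiag, mulVec, dotProduct, Fintype.sum_prod_type, Function.uncurry, ite_mul,
      Finset.sum_ite_irrel]
  rw [h]
  simp [dotProduct, Fintype.sum_prod_type, Function.uncurry]

variable {n : ℕ}

theorem dotProduct_Psi_mulVec (p : ℕ) (R G : Matrix (Fin n) (Fin n) ℝ)
    (x : Fin (p + 1) → Fin n → ℝ) :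
    Function.uncurry x ⬝ᵥ (Psi p R G *ᵥ Function.uncurry x) =
      ∑ k, ∑ l, x k ⬝ᵥ ((if k = l then R else (1 / 2 : ℝ) • (G + Gᵀ)) *ᵥ x l) := by
  have h : Psi p R G *ᵥ Function.uncurry x = Function.uncurry fun k => ∑ l,
      (if k = l then R else (1 / 2 : ℝ) • (G + Gᵀ)) *ᵥ x l := by
    funext a
    simp only [Psi, mulVec, dotProduct, Fintype.sum_prod_type, Function.uncurry, of_apply,
      Finset.sum_apply]
    refine Finset.sum_congr rfl fun l _ => Finset.sum_congr rfl fun c _ => ?_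
    split_ifs <;> rfl
  rw [h]
  simp only [dotProduct, Fintype.sum_prod_type, Function.uncurry, Finset.sum_apply, Finset.mul_sum]
  exact Finset.sum_congr rfl fun k _ => Finset.sum_comm

theorem T_mulVec (p : ℕ) (x : Fin (p + 2) → Fin n → ℝ) :
    T n p *ᵥ Function.uncurry x = Function.uncurry fun k => x k.castSucc - x k.succ := by
  funext a
  simp [T, mulVec, dotProduct, Fintype.sum_prod_type, Function.uncurry, sub_mul,
    Finset.sum_sub_distrib, one_apply, ite_mul]

theorem dotProduct_PsiBar_mulVec (p : ℕ) (R G : Matrix (Fin n) (Fin n) ℝ) (α τ : ℝ)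
    (x : Fin (p + 2) → Fin n → ℝ) :
    Function.uncurry x ⬝ᵥ (PsiBar p R G α τ *ᵥ Function.uncurry x) =
      Real.exp (-2 * α * τ) * ∑ k : Fin (p + 1), ∑ l : Fin (p + 1), (x k.castSucc - x k.succ) ⬝ᵥ
        ((if k = l then R else (1 / 2 : ℝ) • (G + Gᵀ)) *ᵥ (x l.castSucc - x l.succ)) := by
  rw [← dotProduct_Psi_mulVec p R G fun k => x k.castSucc - x k.succ, ← T_mulVec, PsiBar,
    smul_mulVec, dotProduct_smul, smul_eq_mul, ← mulVec_mulVec, ← mulVec_mulVec,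
    dotProduct_transpose_mulVec, dotProduct_comm]

theorem isSymm_Psi {p : ℕ} {R G : Matrix (Fin n) (Fin n) ℝ} (hR : R.IsSymm) :
    (Psi p R G).IsSymm := by
  ext a b
  simp only [Psi, transpose_apply, of_apply]
  by_cases h : a.1 = b.1
  · rw [if_pos h.symm, if_pos h, hR.apply]
  · rw [if_neg (Ne.symm h), if_neg h, Matrix.smul_apply, Matrix.smul_apply, Matrix.add_apply,
      Matrix.add_apply, add_comm, transpose_apply, transpose_apply]

theorem isSymm_PsiBar {p : ℕ} {R G : Matrix (Fin n) (Fin n) ℝ} {α τ : ℝ} (hR : R.IsSymm) :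
    (PsiBar p R G α τ).IsSymm := by
  rw [IsSymm, PsiBar, transpose_smul, transpose_mul, transpose_mul, transpose_transpose,
    isSymm_Psi hR, Matrix.mul_assoc]

/-- The vector `(b, c₁, …, c_p, d)`, the argument `ē` of `Ψ̄` in terms of its partition into the
current state, the samples and the delayed state. -/
def stack {V : Type*} {p : ℕ} (b : V) (c : Fin p → V) (d : V) : Fin (p + 2) → V :=
  Fin.cons (α := fun _ => V) b (Fin.snoc (α := fun _ => V) c d)

theorem sum_stack (p : ℕ) (f : Fin (p + 2) × Fin n → ℝ) :
    ∑ a, f a = ∑ a, f (i₁ p a) + ∑ a, f (i₂ p a) + ∑ a, f (i₃ p a) := by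
  rw [Fintype.sum_prod_type, Fintype.sum_prod_type, Fin.sum_univ_succ, Fin.sum_univ_castSucc,
    ← add_assoc]
  rfl

section Stack

variable {p : ℕ} (b : Fin n → ℝ) (c : Fin p → Fin n → ℝ) (d : Fin n → ℝ)

theorem stack_comp_i₁ : Function.uncurry (stack b c d) ∘ i₁ p = b := rfl

theorem stack_comp_i₂ : Function.uncurry (stack b c d) ∘ i₂ p = Function.uncurry c := by
  funext a
  simp [stack, i₂, Function.uncurry]

theorem stack_comp_i₃ : Function.uncurry (stack b c d) ∘ i₃ p = d := by
  funext a
  simp [stack, i₃, Function.uncurry, ← Fin.succ_last]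

theorem quadratic_stack {M : Matrix (Fin (p + 2) × Fin n) (Fin (p + 2) × Fin n) ℝ}
    (hM : M.IsSymm) :
    Function.uncurry (stack b c d) ⬝ᵥ (M *ᵥ Function.uncurry (stack b c d)) =
      b ⬝ᵥ (M.submatrix (i₁ p) (i₁ p) *ᵥ b) +
      2 * (b ⬝ᵥ (M.submatrix (i₁ p) (i₂ p) *ᵥ Function.uncurry c)) +
      2 * (b ⬝ᵥ (M.submatrix (i₁ p) (i₃ p) *ᵥ d)) +
      Function.uncurry c ⬝ᵥ (M.submatrix (i₂ p) (i₂ p) *ᵥ Function.uncurry c) +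
      2 * (Function.uncurry c ⬝ᵥ (M.submatrix (i₂ p) (i₃ p) *ᵥ d)) +
      d ⬝ᵥ (M.submatrix (i₃ p) (i₃ p) *ᵥ d) := by
  have htranspose : ∀ {γ δ : Type} (f : γ → Fin (p + 2) × Fin n) (g : δ → Fin (p + 2) × Fin n),
      M.submatrix f g = (M.submatrix g f)ᵀ := by
    intro γ δ f g
    rw [transpose_submatrix, hM]
  have hdot : ∀ x y : Fin (p + 2) × Fin n → ℝ, x ⬝ᵥ y = (x ∘ i₁ p) ⬝ᵥ (y ∘ i₁ p) +
      (x ∘ i₂ p) ⬝ᵥ (y ∘ i₂ p) + (x ∘ i₃ p) ⬝ᵥ (y ∘ i₃ p) := fun x y =>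
    sum_stack p fun a => x a * y a
  have hmul : ∀ {γ : Type} (f : γ → Fin (p + 2) × Fin n) (x : Fin (p + 2) × Fin n → ℝ),
      (M *ᵥ x) ∘ f = M.submatrix f (i₁ p) *ᵥ (x ∘ i₁ p) + M.submatrix f (i₂ p) *ᵥ (x ∘ i₂ p) +
        M.submatrix f (i₃ p) *ᵥ (x ∘ i₃ p) := by
    intro γ f x
    funext a
    exact hdot (M (f a)) x
  rw [hdot, hmul, hmul, hmul, stack_comp_i₁, stack_comp_i₂, stack_comp_i₃,
    htranspose (i₂ p) (i₁ p), htranspose (i₃ p) (i₁ p), htranspose (i₃ p) (i₂ p)]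
  simp only [dotProduct_add, dotProduct_transpose_mulVec]
  ring

end Stack

end RRBlock

namespace RRDesign

open RRBlock

variable {N n mw mv : ℕ} {r h : Fin N → ℕ} (d : RRDesign N n r h) (net : RRNetwork N n mw mv r h)

/-- The argument of the quadratic form of `Ξ̄_i`. In the dissipation inequality `a` and `b` are the
derivative and the value of `e_i`, `c` and `z` its samples and its delayed value, `E` and `f` the
current and the sampled errors of the neighbours, and `x` is the disturbance. -/
def stateVec (i : Fin N) (a b : Fin n → ℝ) (c : Fin (net.p i) → Fin n → ℝ) (z : Fin n → ℝ)
    (E f : net.nbr i → Fin n → ℝ) (x : Fin mw ⊕ Fin mv → ℝ) :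
    Fin n ⊕ Fin n ⊕ (Fin (net.p i) × Fin n) ⊕ Fin n ⊕ (net.nbr i × Fin n) ⊕
      (net.nbr i × Fin n) ⊕ (Fin mw ⊕ Fin mv) → ℝ :=
  Sum.elim a (Sum.elim b (Sum.elim (Function.uncurry c) (Sum.elim z
    (Sum.elim (Function.uncurry E) (Sum.elim (Function.uncurry f) x)))))

-- The last term pairs the descriptor form of the error equation with the multiplier
-- `b + ε a + ε̄ ∑ⱼ fⱼ`; it vanishes along trajectories.
theorem quadratic_Xi (γ : ℝ) (i : Fin N) (hR : (d.R i).IsSymm) (hY : ((d.Y i)⁻¹).IsSymm)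
    (hW : ∀ j, (d.W j).IsSymm) (a b : Fin n → ℝ) (c : Fin (net.p i) → Fin n → ℝ) (z : Fin n → ℝ)
    (E f : net.nbr i → Fin n → ℝ) (x : Fin mw ⊕ Fin mv → ℝ) :
    stateVec net i a b c z E f x ⬝ᵥ (d.Xi net γ i *ᵥ stateVec net i a b c z E f x) =
      2 * (b ⬝ᵥ ((d.Y i)⁻¹ *ᵥ a)) + 2 * d.α i * (b ⬝ᵥ ((d.Y i)⁻¹ *ᵥ b)) +
      net.τ i ^ 2 * (a ⬝ᵥ (d.R i *ᵥ a)) +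
      (∑ j ∈ net.outNbr i, net.τ j ^ 2) * (a ⬝ᵥ (d.W i *ᵥ a)) +
      (b ⬝ᵥ (d.S i *ᵥ b) - Real.exp (-2 * d.α i * net.τ i) * (z ⬝ᵥ (d.S i *ᵥ z))) -
      Function.uncurry (stack b c z) ⬝ᵥ (d.PsiBar net i *ᵥ Function.uncurry (stack b c z)) +
      (((net.p i : ℝ) + net.q i) / γ ^ 2 * (b ⬝ᵥ b) - 2 / γ ^ 2 * ∑ j, b ⬝ᵥ E j) -
      (∑ j : net.nbr i, d.pi j * (E j ⬝ᵥ ((d.Y j)⁻¹ *ᵥ E j))) -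
      (∑ j : net.nbr i, Real.pi ^ 2 / 4 * ((E j - f j) ⬝ᵥ (d.W j *ᵥ (E j - f j)))) -
      x ⬝ᵥ x +
      2 * ((b + d.ε i • a + d.εbar i • ∑ j, f j) ⬝ᵥ
        (((d.X i)ᵀ * net.A - d.U i * net.C i) *ᵥ b + ((d.X i)ᵀ * net.B - d.U i * net.D i) *ᵥ x +
          (d.F i * net.H i) *ᵥ (∑ j, f j - ∑ l, c l) - (d.X i)ᵀ *ᵥ a)) := by
  have hAX : net.Aᵀ * d.X i = ((d.X i)ᵀ * net.A)ᵀ := by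
    rw [transpose_mul, transpose_transpose]
  have hCU : (net.C i)ᵀ * (d.U i)ᵀ = (d.U i * net.C i)ᵀ := (transpose_mul _ _).symm
  have hHF : (net.H i)ᵀ * (d.F i)ᵀ = (d.F i * net.H i)ᵀ := (transpose_mul _ _).symm
  have hWcomm : ∀ j : net.nbr i, f j ⬝ᵥ (d.W j *ᵥ E j) = E j ⬝ᵥ (d.W j *ᵥ f j) := fun j =>
    dotProduct_mulVec_comm_of_isSymm (hW j) _ _
  have hYcomm : a ⬝ᵥ ((d.Y i)⁻¹ *ᵥ b) = b ⬝ᵥ ((d.Y i)⁻¹ *ᵥ a) :=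
    dotProduct_mulVec_comm_of_isSymm hY _ _
  rw [quadratic_stack b c z (M := d.PsiBar net i) (isSymm_PsiBar hR)]
  simp only [stateVec, Xi, sym_quadratic, fromCols_mulVec_elim]
  simp only [Xi_aa, Xi_ab, Xi_ac, Xi_af, Xi_ag, Xi_bb, Xi_bc, Xi_be, Xi_bf, Xi_bg, Xi_cf, Xi_ff,
    Xi_fg, Phi₁₁, Phi₁₂, Phi₂₂, PsiT₁₁, PsiT₁₂, PsiT₁₃, PsiT₂₂, PsiT₂₃, PsiT₃₃, hAX, hCU, hHF]
  simp only [add_mulVec, sub_mulVec, neg_mulVec, smul_mulVec, neg_smul, zero_mulVec, one_mulVec,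
    dotProduct_add, dotProduct_sub, dotProduct_neg, dotProduct_smul, dotProduct_zero, smul_eq_mul,
    oneRow_mulVec, dotProduct_oneFull_mulVec, dotProduct_oneCol_mulVec, dotProduct_blkDiag_mulVec,
    mulVec_add, mulVec_sub, mulVec_smul, add_dotProduct, sub_dotProduct, smul_dotProduct,
    dotProduct_transpose_mulVec, hYcomm, hWcomm, Finset.sum_add_distrib, Finset.sum_sub_distrib,
    ← Finset.mul_sum, ← dotProduct_sum]
  ring

end RRDesign

theorem exists_dotProduct_mulVec_le {ι : Type*} [Fintype ι] (Q : Matrix ι ι ℝ) :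
    ∃ C, 0 ≤ C ∧ ∀ x : ι → ℝ, x ⬝ᵥ (Q *ᵥ x) ≤ C * (x ⬝ᵥ x) := by
  refine ⟨∑ a, ∑ b, |Q a b|, by positivity, fun x => ?_⟩
  have hsq : ∀ a, |x a| ^ 2 ≤ x ⬝ᵥ x := fun a => by
    rw [sq_abs, sq]
    exact Finset.single_le_sum (f := fun a => x a * x a) (fun b _ => mul_self_nonneg _)
      (Finset.mem_univ a)
  rw [dotProduct_mulVec_eq_sum_sum, Finset.sum_mul]
  simp only [Finset.sum_mul]
  refine Finset.sum_le_sum fun a _ => Finset.sum_le_sum fun b _ => ?_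
  have hprod : |x a| * |x b| ≤ x ⬝ᵥ x := by
    nlinarith [hsq a, hsq b, sq_nonneg (|x a| - |x b|)]
  calc Q a b * (x a * x b) ≤ |Q a b| * (|x a| * |x b|) := by
        rw [← abs_mul, ← abs_mul]
        exact le_abs_self _
    _ ≤ |Q a b| * (x ⬝ᵥ x) := mul_le_mul_of_nonneg_left hprod (abs_nonneg _)

-- Expand `0 ≤ (x - t Q⁻¹ x)' Q (x - t Q⁻¹ x)` with `t` below the reciprocal of a bound for `Q⁻¹`.
theorem exists_mul_dotProduct_self_le_of_posDef {ι : Type*} [Fintype ι] {Q : Matrix ι ι ℝ}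
    (hQ : Q.PosDef) : ∃ δ, 0 < δ ∧ ∀ x : ι → ℝ, δ * (x ⬝ᵥ x) ≤ x ⬝ᵥ (Q *ᵥ x) := by
  classical
  obtain ⟨C, hC, hbound⟩ := exists_dotProduct_mulVec_le Q⁻¹
  refine ⟨(C + 1)⁻¹, by positivity, fun x => ?_⟩
  set t := (C + 1)⁻¹ with ht
  have hQinv : Q *ᵥ (t • Q⁻¹ *ᵥ x) = t • x := by
    rw [mulVec_smul, mulVec_mulVec, mul_nonsing_inv _ hQ.det_pos.ne'.isUnit, one_mulVec]
  have hexpand := two_mul_dotProduct_mulVec_le hQ.posSemidef x (t • Q⁻¹ *ᵥ x)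
  rw [hQinv, dotProduct_smul, smul_dotProduct, dotProduct_smul, dotProduct_comm (Q⁻¹ *ᵥ x) x,
    smul_eq_mul, smul_eq_mul, smul_eq_mul] at hexpand
  have htC : t * C ≤ 1 := by
    rw [ht, inv_mul_le_one₀ (by positivity)]
    linarith
  have hinv : t * (t * (x ⬝ᵥ (Q⁻¹ *ᵥ x))) ≤ t * (x ⬝ᵥ x) := by
    refine mul_le_mul_of_nonneg_left ?_ (by positivity)
    calc t * (x ⬝ᵥ (Q⁻¹ *ᵥ x)) ≤ t * (C * (x ⬝ᵥ x)) :=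
          mul_le_mul_of_nonneg_left (hbound x) (by positivity)
      _ = t * C * (x ⬝ᵥ x) := (mul_assoc _ _ _).symm
      _ ≤ x ⬝ᵥ x := mul_le_of_le_one_left (dotProduct_self_star_nonneg x) htC
  linarith

/-- `f` has the integral `v` over `[a, b]` with respect to the weight `w`. It pairs integrability
with the value, so that a sum of integrals is evaluated term by term. -/
def HasWeightedIntegral (w : ℝ → ℝ) (a b : ℝ) (f : ℝ → ℝ) (v : ℝ) : Prop :=
  IntervalIntegrable (fun u => w u * f u) volume a b ∧ ∫ u in a..b, w u * f u = v

namespace HasWeightedIntegral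

variable {w : ℝ → ℝ} {a b : ℝ} {f g : ℝ → ℝ} {v v' : ℝ}

theorem add (hf : HasWeightedIntegral w a b f v) (hg : HasWeightedIntegral w a b g v') :
    HasWeightedIntegral w a b (fun u => f u + g u) (v + v') := by
  simp only [HasWeightedIntegral, mul_add]
  exact ⟨hf.1.add hg.1, by rw [intervalIntegral.integral_add hf.1 hg.1, hf.2, hg.2]⟩

theorem sub (hf : HasWeightedIntegral w a b f v) (hg : HasWeightedIntegral w a b g v') :
    HasWeightedIntegral w a b (fun u => f u - g u) (v - v') := by
  simp only [HasWeightedIntegral, mul_sub]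
  exact ⟨hf.1.sub hg.1, by rw [intervalIntegral.integral_sub hf.1 hg.1, hf.2, hg.2]⟩

theorem const_mul (c : ℝ) (hf : HasWeightedIntegral w a b f v) :
    HasWeightedIntegral w a b (fun u => c * f u) (c * v) := by
  simp only [HasWeightedIntegral, mul_left_comm _ c]
  exact ⟨hf.1.const_mul c, by rw [intervalIntegral.integral_const_mul, hf.2]⟩

theorem sum {κ : Type*} {s : Finset κ} {f : κ → ℝ → ℝ} {v : κ → ℝ}
    (hf : ∀ i ∈ s, HasWeightedIntegral w a b (f i) (v i)) :
    HasWeightedIntegral w a b (fun u => ∑ i ∈ s, f i u) (∑ i ∈ s, v i) := by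
  simp only [HasWeightedIntegral, Finset.mul_sum]
  refine ⟨intervalIntegrable_sum fun i hi => (hf i hi).1, ?_⟩
  rw [intervalIntegral.integral_finsetSum fun i hi => (hf i hi).1]
  exact Finset.sum_congr rfl fun i hi => (hf i hi).2

theorem mono (hf : HasWeightedIntegral w a b f v) (hg : HasWeightedIntegral w a b g v')
    (hab : a ≤ b) (hw : ∀ u, 0 ≤ w u) (h : ∀ u ∈ Set.Ioo a b, f u ≤ g u) : v ≤ v' := by
  rw [← hf.2, ← hg.2]
  exact intervalIntegral.integral_mono_on_of_le_Ioo hab hf.1 hg.1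
    fun u hu => mul_le_mul_of_nonneg_left (h u hu) (hw u)

theorem of_intervalIntegrable (hw : Continuous w) (hf : IntervalIntegrable f volume a b) :
    HasWeightedIntegral w a b f (∫ u in a..b, w u * f u) :=
  ⟨hf.continuousOn_mul hw.continuousOn, rfl⟩

theorem of_continuous (hw : Continuous w) (hf : Continuous f) :
    HasWeightedIntegral w a b f (∫ u in a..b, w u * f u) :=
  of_intervalIntegrable hw (hf.intervalIntegrable a b)

end HasWeightedIntegral

theorem intervalIntegrable_quadratic_sub {ι : Type*} [Fintype ι] {f : ℝ → ι → ℝ}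
    (hf : Continuous f) (W : Matrix ι ι ℝ) (v : ι → ℝ) (a b : ℝ) :
    IntervalIntegrable (fun u => (f u - v) ⬝ᵥ (W *ᵥ (f u - v))) volume a b := by
  refine Continuous.intervalIntegrable ?_ a b
  fun_prop

namespace RRNetwork

variable {N n mw mv : ℕ} {r h : Fin N → ℕ} {net : RRNetwork N n mw mv r h}

theorem mem_nbr_iff {i j : Fin N} : j ∈ net.nbr i ↔ i ∈ net.outNbr j := by
  simp only [nbr, outNbr, Finset.mem_filter, Finset.mem_univ, true_and]

theorem sum_nbr_comm {M : Type*} [AddCommMonoid M] (f : Fin N → Fin N → M) :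
    ∑ i, ∑ j ∈ net.nbr i, f i j = ∑ j, ∑ i ∈ net.outNbr j, f i j :=
  Finset.sum_comm' fun i j => by
    simp only [Finset.mem_univ, true_and, and_true, mem_nbr_iff]

theorem intervalIntegrable_sub_held {f : ℝ → Fin n → ℝ} (hf : Continuous f) (i j : Fin N)
    (W : Matrix (Fin n) (Fin n) ℝ) (a b : ℝ) :
    IntervalIntegrable (fun u => (f u - net.held f i j u) ⬝ᵥ (W *ᵥ (f u - net.held f i j u)))
      volume a b := by
  refine intervalIntegrable_quadratic_of_memLp
    (f := fun u => f u - net.held f i j u) (fun c => ?_) W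
  exact (memLp_two_restrict_Ioc_of_continuous ((continuous_apply c).comp hf) _ _).sub
    (net.memLp_held f i j c _ _)

/-- The difference of the two sides of Wirtinger's inequality for `e`, with derivative `g`, on an
interval starting at the sampling instant of the channel `(j, i)` in round `k`. -/
noncomputable def wirtingerGap (net : RRNetwork N n mw mv r h) (W : Matrix (Fin n) (Fin n) ℝ)
    (e g : ℝ → Fin n → ℝ) (i j : Fin N) (k : ℕ) (u : ℝ) : ℝ :=
  net.τ i ^ 2 * (g u ⬝ᵥ (W *ᵥ g u)) - Real.pi ^ 2 / 4 *
    ((e u - e (net.sampleTime i k j)) ⬝ᵥ (W *ᵥ (e u - e (net.sampleTime i k j))))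

/-- The analogue of `wirtingerGap` for the sampled and held version of `e`, with the derivative part
enlarged to absorb the variation of the weight `exp (2 β u)` over one delay `τ_i`. -/
noncomputable def heldWirtingerGap (net : RRNetwork N n mw mv r h) (W : Matrix (Fin n) (Fin n) ℝ)
    (β : ℝ) (e g : ℝ → Fin n → ℝ) (i j : Fin N) (u : ℝ) : ℝ :=
  Real.exp (2 * β * net.τ i) * net.τ i ^ 2 * (g u ⬝ᵥ (W *ᵥ g u)) -
    Real.pi ^ 2 / 4 * ((e u - net.held e i j u) ⬝ᵥ (W *ᵥ (e u - net.held e i j u)))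

section Wirtinger

variable {i j : Fin N} {e g : ℝ → Fin n → ℝ} {W : Matrix (Fin n) (Fin n) ℝ} {β : ℝ} {m k : ℕ}
  {φ : Fin n → ℝ}

theorem intervalIntegrable_wirtingerGap (hp : HasL2Deriv e g) (a b : ℝ) :
    IntervalIntegrable (net.wirtingerGap W e g i j k) volume a b := by
  exact ((hp.intervalIntegrable_quadratic W a b).const_mul _).sub
    ((intervalIntegrable_quadratic_sub hp.continuous W _ a b).const_mul _)

theorem intervalIntegrable_heldWirtingerGap (hp : HasL2Deriv e g) (a b : ℝ) :
    IntervalIntegrable (net.heldWirtingerGap W β e g i j) volume a b := by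
  exact ((hp.intervalIntegrable_quadratic W a b).const_mul _).sub
    ((intervalIntegrable_sub_held hp.continuous i j W a b).const_mul _)

theorem intervalIntegrable_exp_mul_heldWirtingerGap (hp : HasL2Deriv e g) (a b : ℝ) :
    IntervalIntegrable (fun u => Real.exp (2 * β * u) * net.heldWirtingerGap W β e g i j u)
      volume a b :=
  (intervalIntegrable_heldWirtingerGap hp a b).continuousOn_mul (by fun_prop)

theorem integral_wirtingerGap_nonneg (hp : HasL2Deriv e g) (hW : W.PosSemidef)
    (hτ : BddAbove (range (net.pollGap i))) (hj : j ∈ net.nbr i) {t : ℝ}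
    (ht : net.sampleTime i k j ≤ t) (ht' : t ≤ net.t (k + 1)) :
    0 ≤ ∫ u in (net.sampleTime i k j)..t, net.wirtingerGap W e g i j k u := by
  have hwirtinger := hp.wirtinger hW ht (τ := net.τ i) (by linarith [net.sub_sampleTime_le hτ hj k])
  simp only [wirtingerGap]
  rw [intervalIntegral.integral_sub ((hp.intervalIntegrable_quadratic W _ _).const_mul _)
    ((intervalIntegrable_quadratic_sub hp.continuous W _ _ _).const_mul _),
    intervalIntegral.integral_const_mul, intervalIntegral.integral_const_mul]
  linarith

theorem integral_wirtingerGap_eq_zero (hφ : ∀ s ≤ net.t m, e s = φ) (hg : ∀ s ≤ net.t m, g s = 0) :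
    ∫ u in (net.sampleTime i m j)..(net.t m), net.wirtingerGap W e g i j m u = 0 := by
  have hs := net.sampleTime_le i j m
  rw [intervalIntegral.integral_congr (g := fun _ => 0), intervalIntegral.integral_zero]
  intro u hu
  rw [uIcc_of_le hs] at hu
  simp only [wirtingerGap, hg u hu.2, hφ u hu.2, hφ _ hs, sub_self, mulVec_zero, dotProduct_zero,
    mul_zero]

-- The weight of round `k` lies between `exp (2 β u)` and `exp (2 β (u + τ))`, so the derivative
-- part may be increased and the sampling part decreased to these values.
theorem exp_mul_wirtingerGap_le (hW : W.PosSemidef) (hτ : BddAbove (range (net.pollGap i)))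
    (hj : j ∈ net.nbr i) (hβ : 0 ≤ β) {u : ℝ} (hu : net.t k ≤ u) (hu' : u < net.t (k + 1)) :
    Real.exp (2 * β * (net.sampleTime i k j + net.τ i)) * net.wirtingerGap W e g i j k u ≤
      Real.exp (2 * β * u) * net.heldWirtingerGap W β e g i j u := by
  have hlower : Real.exp (2 * β * u) ≤ Real.exp (2 * β * (net.sampleTime i k j + net.τ i)) := by
    gcongr
    linarith [net.sub_sampleTime_le hτ hj k]
  have hupper : Real.exp (2 * β * (net.sampleTime i k j + net.τ i)) ≤
      Real.exp (2 * β * u) * Real.exp (2 * β * net.τ i) := by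
    rw [← Real.exp_add, ← mul_add]
    gcongr
    exact (net.sampleTime_le i j k).trans hu
  simp only [heldWirtingerGap, wirtingerGap, held, net.idx_eq hu hu', mul_sub]
  refine sub_le_sub ?_ ?_
  · rw [mul_assoc (Real.exp _) (_ ^ 2), ← mul_assoc (Real.exp (2 * β * u))]
    exact mul_le_mul_of_nonneg_right hupper
      (mul_nonneg (sq_nonneg _) (dotProduct_mulVec_self_nonneg hW _))
  · exact mul_le_mul_of_nonneg_right hlower
      (mul_nonneg (by positivity) (dotProduct_mulVec_self_nonneg hW _))

theorem exp_mul_integral_wirtingerGap_le_of_mem_Icc (hp : HasL2Deriv e g) (hW : W.PosSemidef)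
    (hτ : BddAbove (range (net.pollGap i))) (hj : j ∈ net.nbr i) (hβ : 0 ≤ β)
    (hstart : Real.exp (2 * β * (net.sampleTime i k j + net.τ i)) *
        ∫ u in (net.sampleTime i k j)..(net.t k), net.wirtingerGap W e g i j k u ≤
      ∫ u in (net.t m)..(net.t k), Real.exp (2 * β * u) * net.heldWirtingerGap W β e g i j u)
    {t : ℝ} (ht : t ∈ Icc (net.t k) (net.t (k + 1))) :
    Real.exp (2 * β * (net.sampleTime i k j + net.τ i)) *
        ∫ u in (net.sampleTime i k j)..t, net.wirtingerGap W e g i j k u ≤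
      ∫ u in (net.t m)..t, Real.exp (2 * β * u) * net.heldWirtingerGap W β e g i j u := by
  have hincrement : Real.exp (2 * β * (net.sampleTime i k j + net.τ i)) *
        ∫ u in (net.t k)..t, net.wirtingerGap W e g i j k u ≤
      ∫ u in (net.t k)..t, Real.exp (2 * β * u) * net.heldWirtingerGap W β e g i j u := by
    rw [← intervalIntegral.integral_const_mul]
    exact intervalIntegral.integral_mono_on_of_le_Ioo ht.1
      ((intervalIntegrable_wirtingerGap hp _ _).const_mul _)
      (intervalIntegrable_exp_mul_heldWirtingerGap hp _ _)
      fun u hu => exp_mul_wirtingerGap_le hW hτ hj hβ hu.1.le (hu.2.trans_le ht.2)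
  rw [← intervalIntegral.integral_add_adjacent_intervals
      (intervalIntegrable_wirtingerGap hp _ (net.t k)) (intervalIntegrable_wirtingerGap hp _ t),
    ← intervalIntegral.integral_add_adjacent_intervals
      (intervalIntegrable_exp_mul_heldWirtingerGap hp _ (net.t k))
      (intervalIntegrable_exp_mul_heldWirtingerGap hp _ t), mul_add]
  exact add_le_add hstart hincrement

-- A new sample resets the left-hand side to `0`; between samples of the channel it only grows as
-- fast as the right-hand side.
theorem exp_mul_integral_wirtingerGap_le (hp : HasL2Deriv e g) (hW : W.PosSemidef)
    (hτ : BddAbove (range (net.pollGap i))) (hj : j ∈ net.nbr i) (hβ : 0 ≤ β)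
    (hφ : ∀ s ≤ net.t m, e s = φ) (hg : ∀ s ≤ net.t m, g s = 0) (hk : m ≤ k) :
    Real.exp (2 * β * (net.sampleTime i k j + net.τ i)) *
        ∫ u in (net.sampleTime i k j)..(net.t k), net.wirtingerGap W e g i j k u ≤
      ∫ u in (net.t m)..(net.t k), Real.exp (2 * β * u) * net.heldWirtingerGap W β e g i j u := by
  induction k, hk using Nat.le_induction with
  | base =>
    rw [integral_wirtingerGap_eq_zero hφ hg, mul_zero, intervalIntegral.integral_same]
  | succ k _ ih =>
    have hlt := (net.t_strictMono k.lt_succ_self).le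
    have hprev := exp_mul_integral_wirtingerGap_le_of_mem_Icc hp hW hτ hj hβ ih
      (right_mem_Icc.2 hlt)
    rcases net.sampleTime_succ hj k with hkeep | hnew
    · simpa only [wirtingerGap, hkeep] using hprev
    · rw [hnew, intervalIntegral.integral_same, mul_zero]
      exact (mul_nonneg (Real.exp_pos _).le (integral_wirtingerGap_nonneg hp hW hτ hj
        ((net.sampleTime_le i j k).trans hlt) le_rfl)).trans hprev

theorem integral_exp_mul_heldWirtingerGap_nonneg (hp : HasL2Deriv e g) (hW : W.PosSemidef)
    (hτ : BddAbove (range (net.pollGap i))) (hj : j ∈ net.nbr i) (hβ : 0 ≤ β)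
    (hφ : ∀ s ≤ net.t m, e s = φ) (hg : ∀ s ≤ net.t m, g s = 0) {T : ℝ} (hT : net.t m ≤ T) :
    0 ≤ ∫ u in (net.t m)..T, Real.exp (2 * β * u) * net.heldWirtingerGap W β e g i j u := by
  have hle := net.t_idx_le ((net.t_nonneg m).trans hT)
  have hlt := (net.lt_t_idx_succ T).le
  have hbound := exp_mul_integral_wirtingerGap_le hp hW hτ hj hβ hφ hg (net.le_idx hT)
  exact (mul_nonneg (Real.exp_pos _).le (integral_wirtingerGap_nonneg hp hW hτ hj
    ((net.sampleTime_le i j _).trans hle) hlt)).trans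
    (exp_mul_integral_wirtingerGap_le_of_mem_Icc hp hW hτ hj hβ hbound ⟨hle, hlt⟩)

end Wirtinger

end RRNetwork

namespace RRBlock

theorem two_mul_dotProduct_symmetrized_mulVec_le {n : ℕ} {R G : Matrix (Fin n) (Fin n) ℝ}
    (hRG : (fromBlocks R G Gᵀ R).PosSemidef) (x y : Fin n → ℝ) :
    2 * (x ⬝ᵥ (((1 / 2 : ℝ) • (G + Gᵀ)) *ᵥ y)) ≤ x ⬝ᵥ (R *ᵥ x) + y ⬝ᵥ (R *ᵥ y) := by
  have hG : ∀ x y : Fin n → ℝ, 2 * (x ⬝ᵥ (G *ᵥ y)) ≤ x ⬝ᵥ (R *ᵥ x) + y ⬝ᵥ (R *ᵥ y) := by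
    intro x y
    have hnonneg : 0 ≤ Sum.elim x (-y) ⬝ᵥ (sym R G R *ᵥ Sum.elim x (-y)) :=
      dotProduct_mulVec_self_nonneg hRG _
    rw [sym_quadratic] at hnonneg
    simp only [mulVec_neg, dotProduct_neg, neg_dotProduct, neg_neg] at hnonneg
    linarith
  have hxy := hG x y
  have hyx := hG y x
  rw [smul_mulVec, add_mulVec, dotProduct_smul, dotProduct_add, dotProduct_transpose_mulVec,
    smul_eq_mul]
  linarith

end RRBlock

namespace RRNetwork

variable {N n mw mv : ℕ} {r h : Fin N → ℕ} (net : RRNetwork N n mw mv r h) (i : Fin N) (u : ℝ)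

/-- The sequence `u, t_k, …, t_{k-p_i+1}, u - τ_i` with `u ∈ [t_k, t_{k+1})`: the times at which
`Ψ̄_i` evaluates the error of node `i`. -/
noncomputable def pollingTime : ℕ → ℝ
  | 0 => u
  | l + 1 => if l < net.p i then net.t (net.idx u - l) else u - net.τ i

theorem pollingTime_last : net.pollingTime i u (net.p i + 1) = u - net.τ i := if_neg (lt_irrefl _)

variable {i u}

theorem pollingTime_succ_le (hτ : BddAbove (range (net.pollGap i))) (hu : 0 ≤ u) {l : ℕ}
    (hl : l < net.p i + 1) : net.pollingTime i u (l + 1) ≤ net.pollingTime i u l := by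
  have hidx := net.t_idx_le hu
  have hidx' := net.lt_t_idx_succ u
  rcases l with _ | l
  · simp only [pollingTime, Nat.sub_zero]
    split_ifs
    · exact hidx
    · exact sub_le_self _ (net.τ_nonneg i)
  · have hlp : l < net.p i := Nat.lt_of_succ_lt_succ hl
    simp only [pollingTime, hlp, if_true]
    split_ifs with hsucc
    · exact net.t_strictMono.monotone (by omega)
    · have hlast : net.idx u - l = net.idx u + 1 - net.p i := by omega
      rw [hlast]
      linarith [net.sub_le_τ hτ (net.idx u)]

open RRBlock in
theorem stack_eq_pollingTime (e : ℝ → Fin n → ℝ) (l : Fin (net.p i + 2)) :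
    stack (e u) (fun l : Fin (net.p i) => e (net.t (net.idx u - l))) (e (u - net.τ i)) l =
      e (net.pollingTime i u l) := by
  induction l using Fin.cases with
  | zero => rfl
  | succ l =>
    induction l using Fin.lastCases with
    | last => simp [stack, pollingTime]
    | cast l => simp [stack, pollingTime]

end RRNetwork

namespace RRDesign

open RRBlock RRNetwork

variable {N n mw mv : ℕ} {r h : Fin N → ℕ} {d : RRDesign N n r h} {net : RRNetwork N n mw mv r h}
  {γ : ℝ}

/-- The synthesis conditions with scalars `ε`, `ε̄` and `π` of arbitrary sign. -/
structure WeaklyFeasible (d : RRDesign N n r h) (net : RRNetwork N n mw mv r h) (γ : ℝ) :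
    Prop where
  posDef_Y : ∀ i, (d.Y i).PosDef
  posSemidef_S : ∀ i, (d.S i).PosSemidef
  posSemidef_W : ∀ i, (d.W i).PosSemidef
  α_pos : ∀ i, 0 < d.α i
  q_mul_pi_le : ∀ i, (net.q i : ℝ) * d.pi i ≤ 2 * d.α i
  posSemidef_RG : ∀ i, (fromBlocks (d.R i) (d.G i) (d.G i)ᵀ (d.R i)).PosSemidef
  posDef_neg_Xi : ∀ i, (-d.Xi net γ i).PosDef

theorem Feasible.weaklyFeasible (hd : d.Feasible net γ) : d.WeaklyFeasible net γ := by
  choose hY _ hS _ hW hα _ hq _ _ hRG hXi using hd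
  exact ⟨hY, hS, hW, hα, fun i => (hq i).le, hRG, hXi⟩

namespace WeaklyFeasible

variable (hd : d.WeaklyFeasible net γ) (i : Fin N)
include hd

theorem posSemidef_R : (d.R i).PosSemidef := (hd.posSemidef_RG i).submatrix Sum.inl

theorem posDef_inv_Y : ((d.Y i)⁻¹).PosDef := (hd.posDef_Y i).inv

theorem isSymm_inv_Y : ((d.Y i)⁻¹).IsSymm := isSymm_of_posSemidef (hd.posDef_inv_Y i).posSemidef

theorem quadratic_inv_Y_nonneg (x : Fin n → ℝ) : 0 ≤ x ⬝ᵥ ((d.Y i)⁻¹ *ᵥ x) :=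
  dotProduct_mulVec_self_nonneg (hd.posDef_inv_Y i).posSemidef x

-- On a vector `(v, 0, …, 0)` with `X v = 0` the quadratic form of `Ξ̄` would be nonnegative.
theorem det_X_ne_zero : (d.X i).det ≠ 0 := by
  intro hdet
  obtain ⟨v, hv, hXv⟩ := exists_mulVec_eq_zero_iff.2 hdet
  have hstate : stateVec net i v 0 0 0 0 0 0 ≠ 0 := fun h0 =>
    hv (funext fun a => congrFun h0 (Sum.inl a))
  have hneg := (hd.posDef_neg_Xi i).dotProduct_mulVec_pos hstate
  have hstack : Function.uncurry (stack (0 : Fin n → ℝ) (0 : Fin (net.p i) → Fin n → ℝ) 0) = 0 := by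
    funext ⟨l, a⟩
    induction l using Fin.cases with
    | zero => rfl
    | succ l => induction l using Fin.lastCases <;> simp [stack]
  rw [star_trivial, neg_mulVec, dotProduct_neg, d.quadratic_Xi net γ i
    (isSymm_of_posSemidef (hd.posSemidef_R i)) (hd.isSymm_inv_Y i)
    fun j => isSymm_of_posSemidef (hd.posSemidef_W j), hstack] at hneg
  have hR := mul_nonneg (sq_nonneg (net.τ i)) (dotProduct_mulVec_self_nonneg (hd.posSemidef_R i) v)
  have hW := mul_nonneg (Finset.sum_nonneg fun j (_ : j ∈ net.outNbr i) => sq_nonneg (net.τ j))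
    (dotProduct_mulVec_self_nonneg (hd.posSemidef_W i) v)
  simp only [Pi.zero_apply, Finset.sum_const_zero, mulVec_zero, mulVec_smul, hXv, sub_zero,
    dotProduct_zero, zero_dotProduct, dotProduct_neg, dotProduct_transpose_mulVec, smul_zero,
    mul_zero, add_zero, zero_add, zero_sub] at hneg
  linarith

end WeaklyFeasible

end RRDesign

namespace RRNetwork

variable {N n mw mv : ℕ} {r h : Fin N → ℕ} {net : RRNetwork N n mw mv r h}

theorem sum_held_sub_held (e : Fin N → ℝ → Fin n → ℝ) (i : Fin N) (u : ℝ) :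
    ∑ j ∈ net.nbr i, (net.held (e j) i j u - net.held (e i) i j u) =
      ∑ j : net.nbr i, net.held (e j) i j u - ∑ l : Fin (net.p i), e i (net.t (net.idx u - l)) := by
  rw [Finset.sum_sub_distrib, Finset.sum_coe_sort (net.nbr i) fun j => net.held (e j) i j u,
    ← Finset.sum_range fun l => e i (net.t (net.idx u - l))]
  exact congrArg _ (net.sum_sampleTime i (net.idx u) (e i))

-- Node `i` occurs in `p_i` of the disagreement terms as the receiver and in `q_i` as the sender.
theorem sum_degree_mul_sub_eq_disagreement (γ : ℝ) (e : Fin N → ℝ → Fin n → ℝ) (u : ℝ) :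
    ∑ i, (((net.p i : ℝ) + net.q i) / γ ^ 2 * (e i u ⬝ᵥ e i u) -
        2 / γ ^ 2 * ∑ j ∈ net.nbr i, e i u ⬝ᵥ e j u) =
      1 / γ ^ 2 * net.disagreement e u := by
  have hsender : ∑ i, ∑ j ∈ net.nbr i, e j u ⬝ᵥ e j u = ∑ i, (net.q i : ℝ) * (e i u ⬝ᵥ e i u) := by
    rw [sum_nbr_comm]
    exact Finset.sum_congr rfl fun j _ => by rw [Finset.sum_const, nsmul_eq_mul, q]
  have hreceiver : ∑ i, ∑ _j ∈ net.nbr i, e i u ⬝ᵥ e i u =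
      ∑ i, (net.p i : ℝ) * (e i u ⬝ᵥ e i u) :=
    Finset.sum_congr rfl fun j _ => by rw [Finset.sum_const, nsmul_eq_mul, p]
  have hexpand : net.disagreement e u = ∑ i, ∑ j ∈ net.nbr i,
      (e j u ⬝ᵥ e j u - 2 * (e i u ⬝ᵥ e j u) + e i u ⬝ᵥ e i u) := by
    refine Finset.sum_congr rfl fun i _ => Finset.sum_congr rfl fun j _ => ?_
    rw [sub_dotProduct, dotProduct_sub, dotProduct_sub, dotProduct_comm (e j u) (e i u)]
    ring
  have hfactor : ∀ i, ((net.p i : ℝ) + net.q i) / γ ^ 2 * (e i u ⬝ᵥ e i u) -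
        2 / γ ^ 2 * ∑ j ∈ net.nbr i, e i u ⬝ᵥ e j u =
      1 / γ ^ 2 * (net.p i * (e i u ⬝ᵥ e i u) + net.q i * (e i u ⬝ᵥ e i u) -
        2 * ∑ j ∈ net.nbr i, e i u ⬝ᵥ e j u) := fun i => by ring
  simp only [hexpand, hfactor, Finset.sum_add_distrib, Finset.sum_sub_distrib, ← Finset.mul_sum,
    hsender, hreceiver]
  ring

theorem sum_heldWirtingerGap (W : Fin N → Matrix (Fin n) (Fin n) ℝ) (β : ℝ)
    (e g : Fin N → ℝ → Fin n → ℝ) (u : ℝ) :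
    ∑ i, ∑ j ∈ net.nbr i, net.heldWirtingerGap (W j) β (e j) (g j) i j u =
      ∑ i, ((∑ j ∈ net.outNbr i, Real.exp (2 * β * net.τ j) * net.τ j ^ 2) *
          (g i u ⬝ᵥ (W i *ᵥ g i u)) -
        ∑ j ∈ net.nbr i, Real.pi ^ 2 / 4 * ((e j u - net.held (e j) i j u) ⬝ᵥ
          (W j *ᵥ (e j u - net.held (e j) i j u)))) := by
  simp only [heldWirtingerGap, Finset.sum_sub_distrib, Finset.sum_mul]
  rw [sum_nbr_comm]

end RRNetwork

namespace RRDesign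

open RRBlock RRNetwork

variable {N n mw mv : ℕ} {r h : Fin N → ℕ} {d : RRDesign N n r h} {net : RRNetwork N n mw mv r h}
  {γ β : ℝ}

/-- The derivative of the error of node `i` under the gains of the design. -/
noncomputable abbrev errorRate (d : RRDesign N n r h) (net : RRNetwork N n mw mv r h)
    (ξ : Fin N → ℝ → (Fin mw ⊕ Fin mv) → ℝ) (m : ℕ) (e : Fin N → ℝ → Fin n → ℝ) (i : Fin N) :
    ℝ → Fin n → ℝ :=
  net.errorRate d.K d.L ξ m e i

/-- The derivative of `V = ∫_{u-τ}^u exp(-2α(u-s)) e(s)'Se(s) ds` plus `2αV`. -/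
noncomputable def delayRate (d : RRDesign N n r h) (net : RRNetwork N n mw mv r h)
    (e : ℝ → Fin n → ℝ) (i : Fin N) (u : ℝ) : ℝ :=
  e u ⬝ᵥ (d.S i *ᵥ e u) - Real.exp (-2 * d.α i * net.τ i) *
    (e (u - net.τ i) ⬝ᵥ (d.S i *ᵥ e (u - net.τ i)))

/-- An upper bound for the derivative of `V = τ ∫_{-τ}^0 ∫_{u+θ}^u exp(-2α(u-s)) g(s)'Rg(s) ds dθ`
plus `2αV`. -/
noncomputable def integralDelayRate (d : RRDesign N n r h) (net : RRNetwork N n mw mv r h)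
    (g : ℝ → Fin n → ℝ) (i : Fin N) (u : ℝ) : ℝ :=
  net.τ i ^ 2 * (g u ⬝ᵥ (d.R i *ᵥ g u)) - Real.exp (-2 * d.α i * net.τ i) *
    (net.τ i * ∫ s in (u - net.τ i)..u, g s ⬝ᵥ (d.R i *ᵥ g s))

/-- `β` is a decay rate if the slack in `Ξ̄_i < 0` pays for the weight `exp (2 β t)` in the energy
estimate: for the derivative of the weight on the `Y`-terms and for its variation over one delay on
the `W`-terms. -/
structure IsDecayRate (d : RRDesign N n r h) (net : RRNetwork N n mw mv r h) (γ β : ℝ) :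
    Prop where
  nonneg : 0 ≤ β
  le_α : ∀ i, β ≤ d.α i
  slack : ∀ i a b c z E f x, 2 * β * (b ⬝ᵥ ((d.Y i)⁻¹ *ᵥ b)) +
      (∑ j ∈ net.outNbr i, (Real.exp (2 * β * net.τ j) - 1) * net.τ j ^ 2) *
        (a ⬝ᵥ (d.W i *ᵥ a)) ≤
    -(stateVec net i a b c z E f x ⬝ᵥ (d.Xi net γ i *ᵥ stateVec net i a b c z E f x))

namespace WeaklyFeasible

variable {i : Fin N} {ξ : Fin N → ℝ → (Fin mw ⊕ Fin mv) → ℝ} {m : ℕ}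
  {φ : Fin N → Fin n → ℝ} {e : Fin N → ℝ → Fin n → ℝ} {u T : ℝ} (hd : d.WeaklyFeasible net γ)
include hd

theorem isDecayRate_zero : d.IsDecayRate net γ 0 where
  nonneg := le_rfl
  le_α i := (hd.α_pos i).le
  slack i a b c z E f x := by
    have hneg := dotProduct_mulVec_self_nonneg (hd.posDef_neg_Xi i).posSemidef
      (stateVec net i a b c z E f x)
    rw [neg_mulVec, dotProduct_neg] at hneg
    simpa only [mul_zero, zero_mul, Real.exp_zero, sub_self, Finset.sum_const_zero, zero_add]
      using hneg

theorem transpose_X_mul_L (i : Fin N) : (d.X i)ᵀ * d.L i = d.U i := by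
  rw [L, ← Matrix.mul_assoc, mul_nonsing_inv _ (by
    rw [det_transpose]; exact (hd.det_X_ne_zero i).isUnit), Matrix.one_mul]

theorem transpose_X_mul_K (i : Fin N) : (d.X i)ᵀ * d.K i = d.F i := by
  rw [K, ← Matrix.mul_assoc, mul_nonsing_inv _ (by
    rw [det_transpose]; exact (hd.det_X_ne_zero i).isUnit), Matrix.one_mul]

theorem transpose_X_mulVec_errorRate (hu : net.t m < u) :
    (d.X i)ᵀ *ᵥ d.errorRate net ξ m e i u =
      ((d.X i)ᵀ * net.A - d.U i * net.C i) *ᵥ e i u +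
      ((d.X i)ᵀ * net.B - d.U i * net.D i) *ᵥ ξ i u +
      (d.F i * net.H i) *ᵥ (∑ j : net.nbr i, net.held (e j) i j u -
        ∑ l : Fin (net.p i), e i (net.t (net.idx u - l))) := by
  rw [errorRate, errorRate_of_lt hu, sum_held_sub_held, mulVec_add, mulVec_add, mulVec_mulVec,
    mulVec_mulVec, mulVec_mulVec, Matrix.mul_sub, Matrix.mul_sub, ← Matrix.mul_assoc,
    ← Matrix.mul_assoc, ← Matrix.mul_assoc, hd.transpose_X_mul_L, hd.transpose_X_mul_K]

theorem quadratic_PsiBar_stack_le (hτ : BddAbove (range (net.pollGap i)))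
    {e g : ℝ → Fin n → ℝ} (hp : HasL2Deriv e g) (hu : 0 ≤ u) :
    Function.uncurry (stack (e u) (fun l : Fin (net.p i) => e (net.t (net.idx u - l)))
        (e (u - net.τ i))) ⬝ᵥ (d.PsiBar net i *ᵥ Function.uncurry (stack (e u)
          (fun l : Fin (net.p i) => e (net.t (net.idx u - l))) (e (u - net.τ i)))) ≤
      Real.exp (-2 * d.α i * net.τ i) *
        (net.τ i * ∫ s in (u - net.τ i)..u, g s ⬝ᵥ (d.R i *ᵥ g s)) := by
  have hconvex := hp.reciprocally_convex (hd.posSemidef_R i)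
    (two_mul_dotProduct_symmetrized_mulVec_le (hd.posSemidef_RG i))
    fun _ => net.pollingTime_succ_le hτ hu
  rw [pollingTime_last, show net.pollingTime i u 0 = u from rfl, sub_sub_cancel] at hconvex
  rw [RRDesign.PsiBar, dotProduct_PsiBar_mulVec]
  refine mul_le_mul_of_nonneg_left (le_of_eq_of_le ?_ hconvex) (Real.exp_pos _).le
  simp only [Finset.sum_range, stack_eq_pollingTime, Fin.val_castSucc, Fin.val_succ, Fin.ext_iff]

theorem node_dissipation (hτ : BddAbove (range (net.pollGap i))) (hβ : d.IsDecayRate net γ β)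
    (hp : HasL2Deriv (e i) (d.errorRate net ξ m e i)) (hu : net.t m < u) :
    2 * (e i u ⬝ᵥ ((d.Y i)⁻¹ *ᵥ d.errorRate net ξ m e i u)) +
        2 * β * (e i u ⬝ᵥ ((d.Y i)⁻¹ *ᵥ e i u)) +
      (2 * d.α i * (e i u ⬝ᵥ ((d.Y i)⁻¹ *ᵥ e i u)) -
        ∑ j ∈ net.nbr i, d.pi j * (e j u ⬝ᵥ ((d.Y j)⁻¹ *ᵥ e j u))) +
      (((net.p i : ℝ) + net.q i) / γ ^ 2 * (e i u ⬝ᵥ e i u) -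
        2 / γ ^ 2 * ∑ j ∈ net.nbr i, e i u ⬝ᵥ e j u) +
      d.delayRate net (e i) i u + d.integralDelayRate net (d.errorRate net ξ m e i) i u +
      ((∑ j ∈ net.outNbr i, Real.exp (2 * β * net.τ j) * net.τ j ^ 2) *
          (d.errorRate net ξ m e i u ⬝ᵥ (d.W i *ᵥ d.errorRate net ξ m e i u)) -
        ∑ j ∈ net.nbr i, Real.pi ^ 2 / 4 * ((e j u - net.held (e j) i j u) ⬝ᵥ
          (d.W j *ᵥ (e j u - net.held (e j) i j u)))) ≤
      ξ i u ⬝ᵥ ξ i u := by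
  have hslack := hβ.slack i (d.errorRate net ξ m e i u) (e i u)
    (fun l => e i (net.t (net.idx u - l))) (e i (u - net.τ i)) (fun j => e j u)
    (fun j => net.held (e j) i j u) (ξ i u)
  have hPsi := hd.quadratic_PsiBar_stack_le hτ hp ((net.t_nonneg m).trans hu.le)
  rw [d.quadratic_Xi net γ i (isSymm_of_posSemidef (hd.posSemidef_R i)) (hd.isSymm_inv_Y i)
    fun j => isSymm_of_posSemidef (hd.posSemidef_W j), hd.transpose_X_mulVec_errorRate hu, sub_self,
    dotProduct_zero, Finset.sum_coe_sort (net.nbr i) fun j => e i u ⬝ᵥ e j u,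
    Finset.sum_coe_sort (net.nbr i) fun j => d.pi j * (e j u ⬝ᵥ ((d.Y j)⁻¹ *ᵥ e j u)),
    Finset.sum_coe_sort (net.nbr i) fun j => Real.pi ^ 2 / 4 *
      ((e j u - net.held (e j) i j u) ⬝ᵥ (d.W j *ᵥ (e j u - net.held (e j) i j u)))] at hslack
  simp only [sub_mul, one_mul, Finset.sum_sub_distrib] at hslack
  simp only [delayRate, integralDelayRate]
  linarith

-- Node `j` receives `π_j V_j` from each of its `q_j` out-neighbours.
theorem sum_decay_sub_interconnection_nonneg (e : Fin N → ℝ → Fin n → ℝ) (u : ℝ) :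
    0 ≤ ∑ i, (2 * d.α i * (e i u ⬝ᵥ ((d.Y i)⁻¹ *ᵥ e i u)) -
      ∑ j ∈ net.nbr i, d.pi j * (e j u ⬝ᵥ ((d.Y j)⁻¹ *ᵥ e j u))) := by
  rw [Finset.sum_sub_distrib, sub_nonneg, sum_nbr_comm]
  refine Finset.sum_le_sum fun i _ => ?_
  rw [Finset.sum_const, nsmul_eq_mul, ← mul_assoc]
  exact mul_le_mul_of_nonneg_right (hd.q_mul_pi_le i) (hd.quadratic_inv_Y_nonneg i _)

theorem sum_dissipation_le (hτ : ∀ i, BddAbove (range (net.pollGap i)))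
    (hβ : d.IsDecayRate net γ β) (hp : ∀ i, HasL2Deriv (e i) (d.errorRate net ξ m e i))
    (hu : net.t m < u) :
    ∑ i, (2 * (e i u ⬝ᵥ ((d.Y i)⁻¹ *ᵥ d.errorRate net ξ m e i u)) +
        2 * β * (e i u ⬝ᵥ ((d.Y i)⁻¹ *ᵥ e i u))) +
      1 / γ ^ 2 * net.disagreement e u + ∑ i, d.delayRate net (e i) i u +
      ∑ i, d.integralDelayRate net (d.errorRate net ξ m e i) i u +
      ∑ i, ∑ j ∈ net.nbr i,
        net.heldWirtingerGap (d.W j) β (e j) (d.errorRate net ξ m e j) i j u ≤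
      ∑ i, ξ i u ⬝ᵥ ξ i u := by
  have hsum := Finset.sum_le_sum fun i (_ : i ∈ Finset.univ) =>
    hd.node_dissipation (hτ i) hβ (hp i) hu
  rw [Finset.sum_add_distrib, Finset.sum_add_distrib, Finset.sum_add_distrib,
    Finset.sum_add_distrib, Finset.sum_add_distrib, sum_degree_mul_sub_eq_disagreement,
    ← sum_heldWirtingerGap] at hsum
  linarith [hd.sum_decay_sub_interconnection_nonneg e u]

end WeaklyFeasible

end RRDesign

theorem HasL2Deriv.hasWeightedIntegral_quadratic {ι : Type*} [Fintype ι] {e g : ℝ → ι → ℝ}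
    (hp : HasL2Deriv e g) {Q : Matrix ι ι ℝ} (hQ : Q.IsSymm) (β a b : ℝ) :
    HasWeightedIntegral (fun u => Real.exp (2 * β * u)) a b
      (fun u => 2 * (e u ⬝ᵥ (Q *ᵥ g u)) + 2 * β * (e u ⬝ᵥ (Q *ᵥ e u)))
      (Real.exp (2 * β * b) * (e b ⬝ᵥ (Q *ᵥ e b)) -
        Real.exp (2 * β * a) * (e a ⬝ᵥ (Q *ᵥ e a))) := by
  have hcont := hp.continuous
  have hderiv : ∀ u ∈ uIcc a b,
      HasDerivAt (fun u => Real.exp (2 * β * u)) (Real.exp (2 * β * u) * (2 * β)) u := fun u _ => by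
    simpa using ((hasDerivAt_id u).const_mul (2 * β)).exp
  refine ⟨?_, ?_⟩
  · refine IntervalIntegrable.continuousOn_mul ?_ (by fun_prop)
    exact ((hp.intervalIntegrable_bilinear Q hcont a b).const_mul 2).add
      (Continuous.intervalIntegrable (by fun_prop) a b)
  · rw [← hp.integral_weighted_quadratic hQ hderiv (by fun_prop)]
    exact intervalIntegral.integral_congr fun u _ => by ring

namespace RRNetwork

variable {N n mw mv : ℕ} {r h : Fin N → ℕ} {net : RRNetwork N n mw mv r h}

theorem continuous_disagreement {e : Fin N → ℝ → Fin n → ℝ} (he : ∀ i, Continuous (e i)) :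
    Continuous (net.disagreement e) := by
  unfold disagreement
  fun_prop

theorem intervalIntegrable_input {ξ : Fin N → ℝ → (Fin mw ⊕ Fin mv) → ℝ} {m : ℕ} {T : ℝ}
    (hξ : ∀ i c, MemLp (fun u => ξ i u c) 2 (volume.restrict (Ioi (net.t m))))
    (hT : net.t m ≤ T) (i : Fin N) :
    IntervalIntegrable (fun u => ξ i u ⬝ᵥ ξ i u) volume (net.t m) T := by
  have hquadratic := intervalIntegrable_quadratic_of_memLp (f := ξ i) (a := net.t m) (b := T)
    (fun c => by
      rw [uIoc_of_le hT]
      exact (hξ i c).mono_measure (Measure.restrict_mono Ioc_subset_Ioi_self le_rfl)) 1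
  simpa only [one_mulVec] using hquadratic

end RRNetwork

namespace RRDesign

open RRNetwork

variable {N n mw mv : ℕ} {r h : Fin N → ℕ} {d : RRDesign N n r h} {net : RRNetwork N n mw mv r h}
  {γ β : ℝ}

theorem integral_exp_mul_delayRate_ge {i : Fin N} {a T : ℝ} {e : ℝ → Fin n → ℝ} {φ : Fin n → ℝ}
    (hS : (d.S i).PosSemidef) (hβ : 0 ≤ β) (hβα : β ≤ d.α i) (he : Continuous e)
    (hφ : ∀ s ≤ a, e s = φ) (hT : a ≤ T) :
    -(Real.exp (-2 * (d.α i - β) * net.τ i) *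
        (net.τ i * (Real.exp (2 * β * a) * (φ ⬝ᵥ (d.S i *ᵥ φ))))) ≤
      ∫ u in a..T, Real.exp (2 * β * u) * d.delayRate net e i u :=
  integral_weighted_sub_delay_ge (σ := fun u => e u ⬝ᵥ (d.S i *ᵥ e u))
    (fun _ => dotProduct_mulVec_self_nonneg hS _) (by fun_prop) (fun u hu => by rw [hφ u hu]) hT
    (net.τ_nonneg i) hβ hβα

section IntegralDelayRate

variable {i : Fin N} {e g : ℝ → Fin n → ℝ}

theorem continuous_delayRate (he : Continuous e) : Continuous (d.delayRate net e i) := by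
  unfold delayRate
  fun_prop

theorem intervalIntegrable_integralDelayRate (hp : HasL2Deriv e g) (a b : ℝ) :
    IntervalIntegrable (d.integralDelayRate net g i) volume a b := by
  have hR := hp.intervalIntegrable_quadratic (d.R i)
  have hdelay := continuous_integral_delay hR (net.τ i)
  exact ((hR a b).const_mul _).sub (Continuous.intervalIntegrable (by fun_prop) a b)

theorem integral_exp_mul_integralDelayRate_nonneg (hp : HasL2Deriv e g) (hR : (d.R i).PosSemidef)
    (hβ : 0 ≤ β) (hβα : β ≤ d.α i) {a T : ℝ} (hg : ∀ s ≤ a, g s = 0) (hT : a ≤ T) :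
    0 ≤ ∫ u in a..T, Real.exp (2 * β * u) * d.integralDelayRate net g i u := by
  have hτ := net.τ_nonneg i
  have hint := hp.intervalIntegrable_quadratic (d.R i)
  have hdelay := continuous_integral_delay hint (net.τ i)
  have hρ : ∀ u, 0 ≤ g u ⬝ᵥ (d.R i *ᵥ g u) := fun u => dotProduct_mulVec_self_nonneg hR _
  set ρI := ∫ u in a..T, Real.exp (2 * β * u) * (g u ⬝ᵥ (d.R i *ᵥ g u))
  have hρI_nonneg : 0 ≤ ρI :=
    intervalIntegral.integral_nonneg hT fun u _ => mul_nonneg (Real.exp_pos _).le (hρ u)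
  have hdelay_le := integral_weighted_delay_le hρ hint
    (fun u hu => by rw [hg u hu, zero_dotProduct]) hT hτ hβ
  have hexp_le : Real.exp (-2 * d.α i * net.τ i) * Real.exp (2 * β * net.τ i) ≤ 1 := by
    rw [← Real.exp_add, Real.exp_le_one_iff]
    nlinarith [mul_nonneg (sub_nonneg.2 hβα) hτ]
  have hweight : Continuous fun u : ℝ => Real.exp (2 * β * u) := by fun_prop
  have hsplit := ((HasWeightedIntegral.of_intervalIntegrable hweight (hint a T)).const_mul
    (net.τ i ^ 2)).sub (((HasWeightedIntegral.of_continuous (a := a) (b := T) hweight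
      hdelay).const_mul (net.τ i)).const_mul (Real.exp (-2 * d.α i * net.τ i)))
  simp only [integralDelayRate]
  rw [hsplit.2, sub_nonneg]
  calc _ ≤ Real.exp (-2 * d.α i * net.τ i) *
          (net.τ i * (Real.exp (2 * β * net.τ i) * (net.τ i * ρI))) := by gcongr
    _ = Real.exp (-2 * d.α i * net.τ i) * Real.exp (2 * β * net.τ i) * (net.τ i ^ 2 * ρI) := by
        ring
    _ ≤ net.τ i ^ 2 * ρI := mul_le_of_le_one_left (by positivity) hexp_le

end IntegralDelayRate

namespace WeaklyFeasible

variable {ξ : Fin N → ℝ → (Fin mw ⊕ Fin mv) → ℝ} {m : ℕ} {φ : Fin N → Fin n → ℝ}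
  {e : Fin N → ℝ → Fin n → ℝ} {T : ℝ}

theorem integral_dissipation_le (hd : d.WeaklyFeasible net γ)
    (hτ : ∀ i, BddAbove (range (net.pollGap i))) (hβ : d.IsDecayRate net γ β)
    (hξ : ∀ i c, MemLp (fun u => ξ i u c) 2 (volume.restrict (Ioi (net.t m))))
    (hp : ∀ i, HasL2Deriv (e i) (d.errorRate net ξ m e i)) (hT : net.t m ≤ T) :
    ∑ i, (Real.exp (2 * β * T) * (e i T ⬝ᵥ ((d.Y i)⁻¹ *ᵥ e i T)) -
        Real.exp (2 * β * net.t m) * (e i (net.t m) ⬝ᵥ ((d.Y i)⁻¹ *ᵥ e i (net.t m)))) +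
      1 / γ ^ 2 * (∫ u in (net.t m)..T, Real.exp (2 * β * u) * net.disagreement e u) +
      ∑ i, (∫ u in (net.t m)..T, Real.exp (2 * β * u) * d.delayRate net (e i) i u) +
      ∑ i, (∫ u in (net.t m)..T, Real.exp (2 * β * u) *
        d.integralDelayRate net (d.errorRate net ξ m e i) i u) +
      ∑ i, ∑ j ∈ net.nbr i, (∫ u in (net.t m)..T, Real.exp (2 * β * u) *
        net.heldWirtingerGap (d.W j) β (e j) (d.errorRate net ξ m e j) i j u) ≤
    ∑ i, ∫ u in (net.t m)..T, Real.exp (2 * β * u) * (ξ i u ⬝ᵥ ξ i u) := by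
  have hcont := fun i => (hp i).continuous
  have hweight : Continuous fun u : ℝ => Real.exp (2 * β * u) := by fun_prop
  have hstorage := HasWeightedIntegral.sum (s := Finset.univ) fun i _ =>
    (hp i).hasWeightedIntegral_quadratic (hd.isSymm_inv_Y i) β (net.t m) T
  have hdisagreement := HasWeightedIntegral.of_continuous (a := net.t m) (b := T) hweight
    (continuous_disagreement (net := net) hcont)
  have hdelay := HasWeightedIntegral.sum (s := Finset.univ) fun i _ =>
    HasWeightedIntegral.of_continuous (a := net.t m) (b := T) hweight
      (continuous_delayRate (d := d) (net := net) (i := i) (hcont i))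
  have hintegralDelay := HasWeightedIntegral.sum (s := Finset.univ) fun i _ =>
    HasWeightedIntegral.of_intervalIntegrable hweight
      (intervalIntegrable_integralDelayRate (d := d) (net := net) (i := i) (hp i) (net.t m) T)
  have hwirtinger := HasWeightedIntegral.sum (s := Finset.univ) fun i _ =>
    HasWeightedIntegral.sum (s := net.nbr i) fun j _ =>
      HasWeightedIntegral.of_intervalIntegrable hweight (intervalIntegrable_heldWirtingerGap
        (net := net) (W := d.W j) (β := β) (i := i) (j := j) (hp j) (net.t m) T)
  have hinput := HasWeightedIntegral.sum (s := Finset.univ) fun i _ =>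
    HasWeightedIntegral.of_intervalIntegrable hweight (intervalIntegrable_input hξ hT i)
  exact ((((hstorage.add (hdisagreement.const_mul (1 / γ ^ 2))).add hdelay).add
    hintegralDelay).add hwirtinger).mono hinput hT (fun u => (Real.exp_pos _).le)
    fun u hu => hd.sum_dissipation_le hτ hβ hp hu.1

theorem energy_le (hd : d.WeaklyFeasible net γ) (hτ : ∀ i, BddAbove (range (net.pollGap i)))
    (hβ : d.IsDecayRate net γ β)
    (hξ : ∀ i c, MemLp (fun u => ξ i u c) 2 (volume.restrict (Ioi (net.t m))))
    (he : net.IsErrorTrajectory d.K d.L ξ m φ e) (hT : net.t m ≤ T) :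
    Real.exp (2 * β * T) * ∑ i, e i T ⬝ᵥ ((d.Y i)⁻¹ *ᵥ e i T) +
        1 / γ ^ 2 * ∫ u in (net.t m)..T, Real.exp (2 * β * u) * net.disagreement e u ≤
      Real.exp (2 * β * net.t m) * ∑ i, (φ i ⬝ᵥ ((d.Y i)⁻¹ *ᵥ φ i) +
        Real.exp (-2 * (d.α i - β) * net.τ i) * net.τ i * (φ i ⬝ᵥ (d.S i *ᵥ φ i))) +
      ∑ i, ∫ u in (net.t m)..T, Real.exp (2 * β * u) * (ξ i u ⬝ᵥ ξ i u) := by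
  have hφ : ∀ i, ∀ s ≤ net.t m, e i s = φ i := he.2.1
  have hp : ∀ i, HasL2Deriv (e i) (d.errorRate net ξ m e i) := he.hasL2Deriv hξ
  have hg : ∀ i, ∀ s ≤ net.t m, d.errorRate net ξ m e i s = 0 := fun i s hs => errorRate_of_le hs i
  have hdissipation := hd.integral_dissipation_le hτ hβ hξ hp hT
  have hdelay := Finset.sum_le_sum fun i (_ : i ∈ Finset.univ) =>
    integral_exp_mul_delayRate_ge (net := net) (hd.posSemidef_S i) hβ.nonneg (hβ.le_α i)
      (he.1 i) (hφ i) hT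
  have hintegralDelay := Finset.sum_nonneg fun i (_ : i ∈ Finset.univ) =>
    integral_exp_mul_integralDelayRate_nonneg (net := net) (hp i) (hd.posSemidef_R i) hβ.nonneg
      (hβ.le_α i) (hg i) hT
  have hwirtinger := Finset.sum_nonneg fun i (_ : i ∈ Finset.univ) =>
    Finset.sum_nonneg fun j hj => integral_exp_mul_heldWirtingerGap_nonneg (hp j)
      (hd.posSemidef_W j) (hτ i) hj hβ.nonneg (hφ j) (hg j) hT
  have hS : ∑ i, Real.exp (-2 * (d.α i - β) * net.τ i) *
      (net.τ i * (Real.exp (2 * β * net.t m) * (φ i ⬝ᵥ (d.S i *ᵥ φ i)))) =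
      Real.exp (2 * β * net.t m) * ∑ i,
        Real.exp (-2 * (d.α i - β) * net.τ i) * net.τ i * (φ i ⬝ᵥ (d.S i *ᵥ φ i)) := by
    rw [Finset.mul_sum]
    exact Finset.sum_congr rfl fun i _ => by ring
  simp only [hφ _ _ le_rfl, Finset.sum_sub_distrib, ← Finset.mul_sum, Finset.sum_neg_distrib]
    at hdissipation hdelay
  rw [Finset.sum_add_distrib, mul_add]
  linarith

end WeaklyFeasible

end RRDesign

theorem intervalIntegrable_mulVec {ι κ : Type*} [Fintype ι] [Fintype κ] (M : Matrix ι κ ℝ)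
    {f : ℝ → κ → ℝ} {c a b : ℝ} (hf : ∀ d, MemLp (fun u => f u d) 2 (volume.restrict (Ioi c)))
    (hca : c ≤ a) (hab : a ≤ b) : IntervalIntegrable (fun u => M *ᵥ f u) volume a b := by
  rw [intervalIntegrable_iff_integrableOn_Ioc_of_le hab]
  refine Integrable.of_eval fun d =>
    (memLp_mulVec M (fun d' => (hf d').mono_measure ?_) d).integrable one_le_two
  exact Measure.restrict_mono (Ioc_subset_Ioi_self.trans (Ioi_subset_Ioi hca)) le_rfl

theorem memLp_sumElim {ι κ : Type*} {w : ℝ → ι → ℝ} {v : ℝ → κ → ℝ} {p : ENNReal} {μ : Measure ℝ}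
    (hw : ∀ c, MemLp (fun u => w u c) p μ) (hv : ∀ c, MemLp (fun u => v u c) p μ) :
    ∀ c, MemLp (fun u => Sum.elim (w u) (v u) c) p μ
  | .inl c => hw c
  | .inr c => hv c

namespace RRNetwork

variable {N n mw mv : ℕ} {r h : Fin N → ℕ} {net : RRNetwork N n mw mv r h}

section ErrorTrajectory

variable {K : ∀ i, Matrix (Fin n) (Fin (h i)) ℝ} {L : ∀ i, Matrix (Fin n) (Fin (r i)) ℝ}
  {x₀ : Fin n → ℝ} {w : ℝ → Fin mw → ℝ} {v : Fin N → ℝ → Fin mv → ℝ} {x : ℝ → Fin n → ℝ}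
  {xh : Fin N → ℝ → Fin n → ℝ}

theorem IsPlantTrajectory.intervalIntegrable (hx : net.IsPlantTrajectory x₀ w x)
    (hw : ∀ c, MemLp (fun u => w u c) 2 (volume.restrict (Ioi 0))) {a b : ℝ} (ha : 0 ≤ a)
    (hab : a ≤ b) : IntervalIntegrable (fun u => net.A *ᵥ x u + net.B₂ *ᵥ w u) volume a b :=
  ((continuous_const.matrix_mulVec hx.1).intervalIntegrable a b).add
    (intervalIntegrable_mulVec net.B₂ hw ha hab)

theorem IsPlantTrajectory.eq_add_integral (hx : net.IsPlantTrajectory x₀ w x)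
    (hw : ∀ c, MemLp (fun u => w u c) 2 (volume.restrict (Ioi 0))) {a b : ℝ} (ha : 0 ≤ a)
    (hab : a ≤ b) : x b = x a + ∫ u in a..b, (net.A *ᵥ x u + net.B₂ *ᵥ w u) := by
  rw [hx.2.2 b (ha.trans hab), hx.2.2 a ha, add_assoc,
    intervalIntegral.integral_add_adjacent_intervals (hx.intervalIntegrable hw le_rfl ha)
      (hx.intervalIntegrable hw ha hab)]

theorem plantRate_sub_observerRate (K : ∀ i, Matrix (Fin n) (Fin (h i)) ℝ)
    (L : ∀ i, Matrix (Fin n) (Fin (r i)) ℝ) (x : ℝ → Fin n → ℝ) (w : ℝ → Fin mw → ℝ)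
    (v : Fin N → ℝ → Fin mv → ℝ) (xh : Fin N → ℝ → Fin n → ℝ) (i : Fin N) (σ : Fin N → ℝ) (u : ℝ) :
    net.A *ᵥ x u + net.B₂ *ᵥ w u - (net.A *ᵥ xh i u +
        L i *ᵥ (net.y x w v i u - net.C i *ᵥ xh i u) +
        K i *ᵥ ∑ j ∈ net.nbr i, net.H i *ᵥ (xh j (σ j) - xh i (σ j))) =
      (net.A - L i * net.C i) *ᵥ (x u - xh i u) +
        (net.B - L i * net.D i) *ᵥ Sum.elim (w u) (v i u) +
        (K i * net.H i) *ᵥ ∑ j ∈ net.nbr i, ((x (σ j) - xh j (σ j)) - (x (σ j) - xh i (σ j))) := by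
  have hsum : ∑ j ∈ net.nbr i, ((x (σ j) - xh j (σ j)) - (x (σ j) - xh i (σ j))) =
      -∑ j ∈ net.nbr i, (xh j (σ j) - xh i (σ j)) := by
    rw [← Finset.sum_neg_distrib]
    exact Finset.sum_congr rfl fun j _ => by abel
  rw [hsum, ← mulVec_sum]
  simp only [y, B, D, sub_mulVec, mulVec_sub, mulVec_add, mulVec_neg, ← mulVec_mulVec,
    RRBlock.fromCols_mulVec_elim, zero_mulVec]
  abel

theorem isErrorTrajectory_sub (hw : ∀ c, MemLp (fun u => w u c) 2 (volume.restrict (Ioi 0)))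
    (hv : ∀ i c, MemLp (fun u => v i u c) 2 (volume.restrict (Ioi 0)))
    (hx : net.IsPlantTrajectory x₀ w x) (hxh : net.IsObserverTrajectory K L (net.y x w v) xh) :
    net.IsErrorTrajectory K L (fun i u => Sum.elim (w u) (v i u)) 0 (fun _ => x₀)
      fun i u => x u - xh i u := by
  refine ⟨fun i => hx.1.sub (hxh.1 i), fun i s hs => ?_, fun i k _ s hs => ?_⟩
  · rw [net.t_zero] at hs
    simp only [hx.2.1 s hs, hxh.2.1 i s hs, sub_zero]
  have hplant := hx.intervalIntegrable hw (net.t_nonneg k) hs.1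
  have herror : IntervalIntegrable (fun u => (net.A - L i * net.C i) *ᵥ (x u - xh i u) +
      (net.B - L i * net.D i) *ᵥ Sum.elim (w u) (v i u) +
      (K i * net.H i) *ᵥ ∑ j ∈ net.nbr i,
        ((x (net.sampleTime i k j) - xh j (net.sampleTime i k j)) -
          (x (net.sampleTime i k j) - xh i (net.sampleTime i k j)))) volume (net.t k) s :=
    (((continuous_const.matrix_mulVec (hx.1.sub (hxh.1 i))).intervalIntegrable _ _).add
      (intervalIntegrable_mulVec _ (memLp_sumElim hw (hv i)) (net.t_nonneg k) hs.1)).add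
      intervalIntegrable_const
  beta_reduce
  rw [hx.eq_add_integral hw (net.t_nonneg k) hs.1, hxh.2.2 i k s hs, add_sub_add_comm]
  refine congrArg _ (eq_sub_of_add_eq' ?_).symm
  rw [← eq_sub_iff_add_eq, ← intervalIntegral.integral_sub hplant herror]
  exact intervalIntegral.integral_congr fun u _ => by
    rw [← net.plantRate_sub_observerRate K L x w v xh i (net.sampleTime i k), sub_sub_cancel]

end ErrorTrajectory

theorem disagreement_sub (x : ℝ → Fin n → ℝ) (xh : Fin N → ℝ → Fin n → ℝ) :
    net.disagreement (fun i u => x u - xh i u) = net.disagreement xh := by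
  funext u
  refine Finset.sum_congr rfl fun i _ => Finset.sum_congr rfl fun j _ => ?_
  rw [sub_sub_sub_cancel_left, ← neg_sub, neg_dotProduct_neg]

theorem disagreement_nonneg (e : Fin N → ℝ → Fin n → ℝ) (u : ℝ) : 0 ≤ net.disagreement e u :=
  Finset.sum_nonneg fun _ _ => Finset.sum_nonneg fun _ _ => dotProduct_self_star_nonneg _

end RRNetwork

theorem exists_sum_le_mul_sum {κ : Type*} [Fintype κ] {X : κ → Type*} {f g : ∀ k, X k → ℝ}
    (hg : ∀ k x, 0 ≤ g k x) (hfg : ∀ k, ∃ C, 0 ≤ C ∧ ∀ x, f k x ≤ C * g k x) :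
    ∃ C, 0 ≤ C ∧ ∀ x : ∀ k, X k, ∑ k, f k (x k) ≤ C * ∑ k, g k (x k) := by
  choose C hC hle using hfg
  refine ⟨∑ k, C k, Finset.sum_nonneg fun k _ => hC k, fun x => ?_⟩
  rw [Finset.mul_sum]
  refine Finset.sum_le_sum fun k _ => (hle k (x k)).trans ?_
  exact mul_le_mul_of_nonneg_right (Finset.single_le_sum (fun l _ => hC l) (Finset.mem_univ k))
    (hg k (x k))

theorem mul_exp_neg_le (t : ℝ) : t * Real.exp (-t) ≤ 1 - Real.exp (-t) := by
  have hmul := mul_le_mul_of_nonneg_right (Real.add_one_le_exp t) (Real.exp_pos (-t)).le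
  rw [← Real.exp_add, add_neg_cancel, Real.exp_zero] at hmul
  linarith

theorem integrableOn_Ioi_and_integral_le {f : ℝ → ℝ} {a M : ℝ} (hf : ∀ T, IntegrableOn f (Ioc a T))
    (hf_nonneg : ∀ u, 0 ≤ f u) (hM : ∀ T, a ≤ T → ∫ u in a..T, f u ≤ M) :
    IntegrableOn f (Ioi a) ∧ ∫ u in Ioi a, f u ≤ M := by
  have hevent : ∀ᶠ T in atTop, ∫ u in a..T, f u ≤ M := (eventually_ge_atTop a).mono hM
  have hint : IntegrableOn f (Ioi a) := by
    refine integrableOn_Ioi_of_intervalIntegral_norm_bounded M a hf tendsto_id ?_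
    simpa only [Real.norm_of_nonneg (hf_nonneg _)] using hevent
  exact ⟨hint, le_of_tendsto (intervalIntegral_tendsto_integral_Ioi a hint tendsto_id) hevent⟩

namespace RRDesign

open RRBlock RRNetwork

variable {N n mw mv : ℕ} {r h : Fin N → ℕ} {d : RRDesign N n r h} {net : RRNetwork N n mw mv r h}
  {γ β : ℝ}

theorem dotProduct_self_add_le_stateVec (i : Fin N) (a b : Fin n → ℝ)
    (c : Fin (net.p i) → Fin n → ℝ) (z : Fin n → ℝ) (E f : net.nbr i → Fin n → ℝ)
    (x : Fin mw ⊕ Fin mv → ℝ) :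
    a ⬝ᵥ a + b ⬝ᵥ b ≤ stateVec net i a b c z E f x ⬝ᵥ stateVec net i a b c z E f x := by
  simp only [stateVec, sumElim_dotProduct_sumElim]
  rw [← add_assoc]
  refine le_add_of_nonneg_right ?_
  repeat' apply add_nonneg
  all_goals exact dotProduct_self_star_nonneg _

namespace WeaklyFeasible

variable (hd : d.WeaklyFeasible net γ)
include hd

theorem exists_small_decay {δ CY CW : Fin N → ℝ} (hδ : ∀ i, 0 < δ i) :
    ∃ β > 0, ∀ i, β < d.α i ∧ 2 * β * CY i < δ i ∧
      (∑ j ∈ net.outNbr i, (Real.exp (2 * β * net.τ j) - 1) * net.τ j ^ 2) * CW i < δ i := by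
  have hsmall : ∀ᶠ β in 𝓝 (0 : ℝ), ∀ i, β < d.α i ∧ 2 * β * CY i < δ i ∧
      (∑ j ∈ net.outNbr i, (Real.exp (2 * β * net.τ j) - 1) * net.τ j ^ 2) * CW i < δ i := by
    refine eventually_all.2 fun i => (gt_mem_nhds (hd.α_pos i)).and (.and ?_ ?_)
    · have hcont : Continuous fun β : ℝ => 2 * β * CY i := by fun_prop
      exact hcont.continuousAt.eventually_lt continuousAt_const (by simpa using hδ i)
    · have hcont : Continuous fun β : ℝ =>
          (∑ j ∈ net.outNbr i, (Real.exp (2 * β * net.τ j) - 1) * net.τ j ^ 2) * CW i := by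
        fun_prop
      exact hcont.continuousAt.eventually_lt continuousAt_const (by simpa using hδ i)
  obtain ⟨β, hβ, hβ_pos⟩ :=
    ((hsmall.filter_mono nhdsWithin_le_nhds).and (self_mem_nhdsWithin (s := Ioi 0))).exists
  exact ⟨β, hβ_pos, hβ⟩

theorem exists_isDecayRate_pos : ∃ β > 0, d.IsDecayRate net γ β := by
  choose δ hδ hXi using fun i => exists_mul_dotProduct_self_le_of_posDef (hd.posDef_neg_Xi i)
  choose CY _ hCY using fun i => exists_dotProduct_mulVec_le (d.Y i)⁻¹
  choose CW _ hCW using fun i => exists_dotProduct_mulVec_le (d.W i)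
  obtain ⟨β, hβ, hsmall⟩ := hd.exists_small_decay (CY := CY) (CW := CW) hδ
  refine ⟨β, hβ, hβ.le, fun i => (hsmall i).1.le, fun i a b c z E f x => ?_⟩
  have hvariation : 0 ≤ ∑ j ∈ net.outNbr i, (Real.exp (2 * β * net.τ j) - 1) * net.τ j ^ 2 :=
    Finset.sum_nonneg fun j _ => mul_nonneg (sub_nonneg.2 (Real.one_le_exp
      (mul_nonneg (by positivity) (net.τ_nonneg j)))) (sq_nonneg _)
  have hY : 2 * β * (b ⬝ᵥ ((d.Y i)⁻¹ *ᵥ b)) ≤ δ i * (b ⬝ᵥ b) := by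
    refine (mul_le_mul_of_nonneg_left (hCY i b) (by positivity)).trans ?_
    rw [← mul_assoc]
    exact mul_le_mul_of_nonneg_right (hsmall i).2.1.le (dotProduct_self_star_nonneg b)
  have hW : (∑ j ∈ net.outNbr i, (Real.exp (2 * β * net.τ j) - 1) * net.τ j ^ 2) *
      (a ⬝ᵥ (d.W i *ᵥ a)) ≤ δ i * (a ⬝ᵥ a) := by
    refine (mul_le_mul_of_nonneg_left (hCW i a) hvariation).trans ?_
    rw [← mul_assoc]
    exact mul_le_mul_of_nonneg_right (hsmall i).2.2.le (dotProduct_self_star_nonneg a)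
  have hnorm := mul_le_mul_of_nonneg_left (dotProduct_self_add_le_stateVec i a b c z E f x)
    (hδ i).le
  have hdefinite := hXi i (stateVec net i a b c z E f x)
  rw [neg_mulVec, dotProduct_neg] at hdefinite
  linarith

theorem exists_sum_dotProduct_self_le : ∃ C, 0 ≤ C ∧ ∀ e : Fin N → Fin n → ℝ,
    ∑ i, e i ⬝ᵥ e i ≤ C * ∑ i, e i ⬝ᵥ ((d.Y i)⁻¹ *ᵥ e i) := by
  refine exists_sum_le_mul_sum (f := fun _ x => x ⬝ᵥ x) hd.quadratic_inv_Y_nonneg fun i => ?_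
  obtain ⟨l, hl, hle⟩ := exists_mul_dotProduct_self_le_of_posDef (hd.posDef_inv_Y i)
  exact ⟨l⁻¹, (inv_pos.2 hl).le, fun x => (le_inv_mul_iff₀ hl).2 (hle x)⟩

theorem exists_initialEnergy_le : ∃ C, 0 ≤ C ∧ ∀ β, d.IsDecayRate net γ β →
    ∀ φ : Fin N → Fin n → ℝ, ∑ i, (φ i ⬝ᵥ ((d.Y i)⁻¹ *ᵥ φ i) +
      Real.exp (-2 * (d.α i - β) * net.τ i) * net.τ i * (φ i ⬝ᵥ (d.S i *ᵥ φ i))) ≤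
    C * ∑ i, φ i ⬝ᵥ φ i := by
  obtain ⟨C, hC, hle⟩ := exists_sum_le_mul_sum (g := fun _ x => x ⬝ᵥ x)
    (fun _ x => dotProduct_self_star_nonneg x)
    fun i => exists_dotProduct_mulVec_le ((d.Y i)⁻¹ + net.τ i • d.S i)
  refine ⟨C, hC, fun β hβ φ => (Finset.sum_le_sum fun i _ => ?_).trans (hle φ)⟩
  have hexp : Real.exp (-2 * (d.α i - β) * net.τ i) ≤ 1 := Real.exp_le_one_iff.2
    (by nlinarith [mul_nonneg (sub_nonneg.2 (hβ.le_α i)) (net.τ_nonneg i)])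
  rw [add_mulVec, dotProduct_add, smul_mulVec, dotProduct_smul, smul_eq_mul]
  exact add_le_add_right (mul_le_mul_of_nonneg_right
    (mul_le_of_le_one_left (net.τ_nonneg i) hexp)
    (dotProduct_mulVec_self_nonneg (hd.posSemidef_S i) _)) _

theorem sum_quadratic_inv_Y_le (hτ : ∀ i, BddAbove (range (net.pollGap i)))
    (hβ : d.IsDecayRate net γ β) {m : ℕ} {φ : Fin N → Fin n → ℝ} {e : Fin N → ℝ → Fin n → ℝ}
    (he : net.IsErrorTrajectory d.K d.L (fun _ _ => 0) m φ e) {s : ℝ} (hs : net.t m ≤ s) :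
    ∑ i, e i s ⬝ᵥ ((d.Y i)⁻¹ *ᵥ e i s) ≤ Real.exp (-2 * β * (s - net.t m)) *
      ∑ i, (φ i ⬝ᵥ ((d.Y i)⁻¹ *ᵥ φ i) +
        Real.exp (-2 * (d.α i - β) * net.τ i) * net.τ i * (φ i ⬝ᵥ (d.S i *ᵥ φ i))) := by
  have henergy := hd.energy_le (ξ := fun _ _ => 0) hτ hβ (fun _ _ => MemLp.zero) he hs
  have hdisagreement : 0 ≤ 1 / γ ^ 2 *
      ∫ u in (net.t m)..s, Real.exp (2 * β * u) * net.disagreement e u :=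
    mul_nonneg (by positivity) (intervalIntegral.integral_nonneg hs fun u _ =>
      mul_nonneg (Real.exp_pos _).le (disagreement_nonneg e u))
  simp only [zero_dotProduct, mul_zero, intervalIntegral.integral_zero, Finset.sum_const_zero,
    add_zero] at henergy
  have hexp : Real.exp (2 * β * s) * Real.exp (-2 * β * (s - net.t m)) =
      Real.exp (2 * β * net.t m) := by
    rw [← Real.exp_add]
    ring_nf
  refine le_of_mul_le_mul_left ?_ (Real.exp_pos (2 * β * s))
  rw [← mul_assoc, hexp]
  linarith

theorem exponentiallyStable (hτ : ∀ i, BddAbove (range (net.pollGap i))) :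
    net.ExponentiallyStable d.K d.L := by
  obtain ⟨β, hβ, hrate⟩ := hd.exists_isDecayRate_pos
  obtain ⟨Λ, hΛ, hlower⟩ := hd.exists_sum_dotProduct_self_le
  obtain ⟨C, hC, hupper⟩ := hd.exists_initialEnergy_le
  refine ⟨Λ * C + 1, by positivity, β, hβ, fun m φ e he s hs => ?_⟩
  have hφ : 0 ≤ ∑ i, φ i ⬝ᵥ φ i := Finset.sum_nonneg fun i _ => dotProduct_self_star_nonneg _
  calc ∑ i, e i s ⬝ᵥ e i s ≤ Λ * ∑ i, e i s ⬝ᵥ ((d.Y i)⁻¹ *ᵥ e i s) := hlower _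
    _ ≤ Λ * (Real.exp (-2 * β * (s - net.t m)) * (C * ∑ i, φ i ⬝ᵥ φ i)) := by
        gcongr
        exact (hd.sum_quadratic_inv_Y_le hτ hrate he hs).trans
          (mul_le_mul_of_nonneg_left (hupper β hrate φ) (Real.exp_pos _).le)
    _ = Λ * C * Real.exp (-2 * β * (s - net.t m)) * ∑ i, φ i ⬝ᵥ φ i := by ring
    _ ≤ (Λ * C + 1) * Real.exp (-2 * β * (s - net.t m)) * ∑ i, φ i ⬝ᵥ φ i := by
        gcongr
        exact le_add_of_nonneg_right zero_le_one

end WeaklyFeasible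

end RRDesign

namespace RRDesign

open RRNetwork

variable {N n mw mv : ℕ} {r h : Fin N → ℕ} {d : RRDesign N n r h} {net : RRNetwork N n mw mv r h}
  {γ : ℝ}

theorem exp_mul_le_weight {α : ℝ} (hα : 0 < α) (τ : ℝ) :
    Real.exp (-2 * α * τ) * τ ≤ (1 - Real.exp (-2 * α * τ)) / (2 * α) := by
  rw [le_div_iff₀ (by positivity)]
  calc Real.exp (-2 * α * τ) * τ * (2 * α) = 2 * α * τ * Real.exp (-(2 * α * τ)) := by ring_nf
    _ ≤ 1 - Real.exp (-(2 * α * τ)) := mul_exp_neg_le _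
    _ = 1 - Real.exp (-2 * α * τ) := by ring_nf

theorem quadratic_P (hN : 0 < N) (d : RRDesign N n r h) (net : RRNetwork N n mw mv r h)
    (x : Fin n → ℝ) : (N : ℝ) * (x ⬝ᵥ (d.P net *ᵥ x)) = ∑ i, (x ⬝ᵥ ((d.Y i)⁻¹ *ᵥ x) +
      (1 - Real.exp (-2 * d.α i * net.τ i)) / (2 * d.α i) * (x ⬝ᵥ (d.S i *ᵥ x))) := by
  simp only [P, smul_mulVec, dotProduct_smul, sum_mulVec, dotProduct_sum, add_mulVec,
    dotProduct_add, smul_eq_mul]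
  rw [← mul_assoc, mul_one_div_cancel (by positivity), one_mul]

namespace WeaklyFeasible

section Weight

variable (hd : d.WeaklyFeasible net γ) (hN : 0 < N)
include hd hN

theorem posDef_P : (d.P net).PosDef := by
  have : Nonempty (Fin N) := ⟨⟨0, hN⟩⟩
  refine PosDef.smul (Matrix.posDef_sum Finset.univ_nonempty fun i _ => ?_) (by positivity)
  refine (hd.posDef_inv_Y i).add_posSemidef ((hd.posSemidef_S i).smul ?_)
  exact (mul_nonneg (Real.exp_pos _).le (net.τ_nonneg i)).trans (exp_mul_le_weight (hd.α_pos i) _)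

theorem initialEnergy_le_P (x : Fin n → ℝ) :
    ∑ i, (x ⬝ᵥ ((d.Y i)⁻¹ *ᵥ x) +
      Real.exp (-2 * d.α i * net.τ i) * net.τ i * (x ⬝ᵥ (d.S i *ᵥ x))) ≤
    N * (x ⬝ᵥ (d.P net *ᵥ x)) := by
  rw [quadratic_P hN]
  gcongr with i
  · exact dotProduct_mulVec_self_nonneg (hd.posSemidef_S i) x
  · exact exp_mul_le_weight (hd.α_pos i) _

end Weight

variable {x₀ : Fin n → ℝ} {w : ℝ → Fin mw → ℝ} {v : Fin N → ℝ → Fin mv → ℝ} {x : ℝ → Fin n → ℝ}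
  {xh : Fin N → ℝ → Fin n → ℝ}

theorem integral_disagreement_le (hd : d.WeaklyFeasible net γ) (hN : 0 < N)
    (hτ : ∀ i, BddAbove (range (net.pollGap i))) (hγ : 0 < γ)
    (hw : ∀ c, MemLp (fun u => w u c) 2 (volume.restrict (Ioi 0)))
    (hv : ∀ i c, MemLp (fun u => v i u c) 2 (volume.restrict (Ioi 0)))
    (hx : net.IsPlantTrajectory x₀ w x) (hxh : net.IsObserverTrajectory d.K d.L (net.y x w v) xh)
    {T : ℝ} (hT : 0 ≤ T) :
    ∫ u in (0 : ℝ)..T, net.disagreement xh u ≤ γ ^ 2 * (N * (x₀ ⬝ᵥ (d.P net *ᵥ x₀)) +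
      ∑ i, ∫ u in Ioi (0 : ℝ), (w u ⬝ᵥ w u + v i u ⬝ᵥ v i u)) := by
  have hξ := fun i => memLp_sumElim hw (hv i)
  have henergy := hd.energy_le (T := T) hτ hd.isDecayRate_zero (by rwa [net.t_zero])
    (isErrorTrajectory_sub hw hv hx hxh) (by rwa [net.t_zero])
  simp only [disagreement_sub, mul_zero, zero_mul, Real.exp_zero, one_mul, net.t_zero, sub_zero,
    sumElim_dotProduct_sumElim] at henergy
  have hterminal : 0 ≤ ∑ i, (x T - xh i T) ⬝ᵥ ((d.Y i)⁻¹ *ᵥ (x T - xh i T)) :=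
    Finset.sum_nonneg fun i _ => hd.quadratic_inv_Y_nonneg i _
  have hinput : ∑ i, ∫ u in (0 : ℝ)..T, (w u ⬝ᵥ w u + v i u ⬝ᵥ v i u) ≤
      ∑ i, ∫ u in Ioi (0 : ℝ), (w u ⬝ᵥ w u + v i u ⬝ᵥ v i u) := by
    refine Finset.sum_le_sum fun i _ => ?_
    rw [intervalIntegral.integral_of_le hT]
    refine setIntegral_mono_set ?_ (.of_forall fun u => ?_) (.of_forall Ioc_subset_Ioi_self)
    · exact (integrable_finsetSum _ fun c _ => (hw c).integrable_mul (hw c)).add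
        (integrable_finsetSum _ fun c _ => (hv i c).integrable_mul (hv i c))
    · exact add_nonneg (dotProduct_self_star_nonneg _) (dotProduct_self_star_nonneg _)
  have hinitial := hd.initialEnergy_le_P hN x₀
  have hbound : 1 / γ ^ 2 * ∫ u in (0 : ℝ)..T, net.disagreement xh u ≤
      N * (x₀ ⬝ᵥ (d.P net *ᵥ x₀)) +
        ∑ i, ∫ u in Ioi (0 : ℝ), (w u ⬝ᵥ w u + v i u ⬝ᵥ v i u) := by linarith
  rwa [one_div, inv_mul_le_iff₀ (by positivity)] at hbound

theorem consensusPerformance (hd : d.WeaklyFeasible net γ) (hN : 0 < N)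
    (hτ : ∀ i, BddAbove (range (net.pollGap i))) (hγ : 0 < γ) :
    net.ConsensusPerformance d.K d.L γ (d.P net) := by
  intro x₀ w v x xh hw hv hx hxh
  obtain ⟨hint, hle⟩ := integrableOn_Ioi_and_integral_le
    (fun T => ((continuous_disagreement hxh.1).integrableOn_Icc.mono_set Ioc_subset_Icc_self))
    (disagreement_nonneg xh) fun T hT =>
      hd.integral_disagreement_le hN hτ hγ (fun c => hw.eval c) (fun i c => (hv i).eval c) hx hxh hT
  refine ⟨hint, (mul_le_mul_of_nonneg_left hle (by positivity)).trans_eq ?_⟩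
  field_simp

end WeaklyFeasible

end RRDesign

theorem theorem2_general {N n mw mv : ℕ} (hN : 0 < N) {r h : Fin N → ℕ}
    (net : RRNetwork N n mw mv r h) (hτ : ∀ i, BddAbove (range (net.pollGap i))) (γ : ℝ)
    (hγ : 0 < γ) (d : RRDesign N n r h) (hd : d.WeaklyFeasible net γ) :
    net.SolvesEstimationProblem d.K d.L γ (d.P net) :=
  ⟨hd.exponentiallyStable hτ, hd.posDef_P hN, hd.consensusPerformance hN hτ hγ⟩

theorem theorem2 {N n mw mv : ℕ} (hN : 0 < N) {r h : Fin N → ℕ}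
    (net : RRNetwork N n mw mv r h)
    (hτ : ∀ i, BddAbove (Set.range (net.pollGap i)))
    (γ : ℝ) (hγ : 0 < γ)
    (d : RRDesign N n r h) (hd : d.Feasible net γ) :
    net.SolvesEstimationProblem d.K d.L γ (d.P net) :=
  theorem2_general hN net hτ γ hγ d hd.weaklyFeasible
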